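/- Let $R$ be a commutative ring in which every stably free module is free, where an $R$-module $P$ is called stably free if $P\oplus N\cong M$ for some finitely generated free $R$-modules $N$ and $M$. Let $n\ge 0$. Let $\mathrm{CB}(R^n)$ be the simplicial complex whose simplices are the non-empty finite sets $\{M_1,\dots,M_r\}$ of proper non-zero free direct summands of $R^n$ for which there is a basis $B$ of $R^n$ that contains a basis of $M_i$ for every $1\le i\le r$. A partial direct sum decomposition of $R^n$ is a subset of a finite set $\{N_1,\dots,N_r\}$ of non-zero free submodules with $R^n=N_1\oplus\dots\oplus N_r$. Let $\mathrm{PD}(R^n)$ be the poset of all partial direct sum decompositions of $R^n$, ordered by refinement: $\sigma\le\sigma'$ if and only if for every $N\in\sigma$ there is $N'\in\sigma'$ with $N\subseteq N'$. Let $\overline{\mathrm{PD}}(R^n)=\mathrm{PD}(R^n)\setminus\{\emptyset,\{R^n\}\}$ be its proper part, regarded as a topological space through the geometric realization of its order complex, whose simplices are the non-empty finite chains. The group $\mathrm{GL}_n(R)$ acts on both objects by $M\mapsto gM$ on submodules. Then the geometric realizations (with the weak topology) of $\mathrm{CB}(R^n)$ and of $\overline{\mathrm{PD}}(R^n)$ are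 $\mathrm{GL}_n(R)$-homotopy equivalent: there are $\mathrm{GL}_n(R)$-equivariant continuous maps $f\colon|\mathrm{CB}(R^n)|\to|\overline{\mathrm{PD}}(R^n)|$ and $h\colon|\overline{\mathrm{PD}}(R^n)|\to|\mathrm{CB}(R^n)|$ such that $h\circ f$ and $f\circ h$ are homotopic to the respective identity maps through $\mathrm{GL}_n(R)$-equivariant maps. -/

import Mathlib

open scoped MatrixGroups

universe u

noncomputable section

/-! ### Simplicial complexes, geometric realizations and group actions -/

namespace PreAbstractSimplicialComplex

variable {V : Type*}

/-- The points of the geometric realization of a simplicial complex: formal convex combinations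
of vertices whose support is a simplex. -/
@[ext]
structure Realization (K : PreAbstractSimplicialComplex V) where
  /-- the barycentric coordinates -/
  weight : V →₀ ℝ
  nonneg : ∀ v, 0 ≤ weight v
  sum_eq_one : (weight.sum fun _ a => a) = 1
  support_mem : weight.support ∈ K.faces

/-- The closed simplex spanned by `s` inside the geometric realization. -/
def closedSimplex (K : PreAbstractSimplicialComplex V) (s : Finset V) : Set K.Realization :=
  {x | x.weight.support ⊆ s}

/-- Each closed simplex carries its Euclidean topology, that is the topology of pointwise
convergence of the (finitely many nonzero) barycentric coordinates. -/
@[reducible]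
def closedSimplexTopology (K : PreAbstractSimplicialComplex V) (s : Finset V) :
    TopologicalSpace (K.closedSimplex s) :=
  TopologicalSpace.induced (fun x (v : V) => x.1.weight v) Pi.topologicalSpace

/-- The weak (coherent) topology on the geometric realization: a set is open if and only if its
intersection with every closed simplex is open in that simplex. -/
instance instTopologicalSpaceRealization (K : PreAbstractSimplicialComplex V) :
    TopologicalSpace K.Realization :=
  ⨆ s : {s : Finset V // s ∈ K.faces},
    TopologicalSpace.coinduced Subtype.val (K.closedSimplexTopology s.1)

/-- A simplicial complex is invariant under an action of `G` on the vertices if `G` maps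
simplices to simplices. -/
class IsInvariant (G : Type*) [Group G] [MulAction G V] (K : PreAbstractSimplicialComplex V) :
    Prop where
  map_mem : ∀ (g : G) (s : Finset V), s ∈ K.faces →
    s.map (MulAction.toPerm g).toEmbedding ∈ K.faces

/-- The induced action on the geometric realization, `g • ∑ tᵢ vᵢ = ∑ tᵢ (g • vᵢ)`. -/
instance instMulActionRealization (G : Type*) [Group G] [MulAction G V]
    (K : PreAbstractSimplicialComplex V) [K.IsInvariant G] : MulAction G K.Realization where
  smul g x :=
    { weight := x.weight.embDomain (MulAction.toPerm g).toEmbedding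
      nonneg := by
        intro v
        obtain ⟨w, rfl⟩ := (MulAction.toPerm g).surjective v
        have := Finsupp.embDomain_apply_self (MulAction.toPerm g).toEmbedding x.weight w
        rw [Equiv.coe_toEmbedding] at this
        rw [this]
        exact x.nonneg w
      sum_eq_one := by
        rw [← x.sum_eq_one, Finsupp.sum_embDomain]
      support_mem := by
        rw [Finsupp.support_embDomain]
        exact IsInvariant.map_mem g _ x.support_mem }
  one_smul x := by
    apply Realization.ext
    change x.weight.embDomain (MulAction.toPerm (1 : G)).toEmbedding = x.weight
    rw [Finsupp.embDomain_eq_mapDomain]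
    have : ((MulAction.toPerm (1 : G) : Equiv.Perm V).toEmbedding : V → V) = id := by
      funext v
      simp
    rw [this, Finsupp.mapDomain_id]
  mul_smul g h x := by
    apply Realization.ext
    change x.weight.embDomain (MulAction.toPerm (g * h)).toEmbedding =
      (x.weight.embDomain (MulAction.toPerm h).toEmbedding).embDomain
        (MulAction.toPerm g).toEmbedding
    rw [Finsupp.embDomain_eq_mapDomain, Finsupp.embDomain_eq_mapDomain,
      Finsupp.embDomain_eq_mapDomain, ← Finsupp.mapDomain_comp]
    congr 1
    funext v
    simp [mul_smul]

end PreAbstractSimplicialComplex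

/-- The order complex of a poset: its simplices are the non-empty finite chains. -/
def orderComplex (P : Type*) [PartialOrder P] : PreAbstractSimplicialComplex P where
  faces := {c | c.Nonempty ∧ IsChain (· ≤ ·) (c : Set P)}
  isRelLowerSet_faces := fun _ hc =>
    ⟨hc.1, fun _ hdc hd => ⟨hd, hc.2.mono (Finset.coe_subset.2 hdc)⟩⟩

/-- A group acting on a poset by order-preserving maps acts on the order complex. -/
instance orderComplex_isInvariant (G P : Type*) [Group G] [PartialOrder P] [MulAction G P]
    [CovariantClass G P HSMul.hSMul LE.le] : (orderComplex P).IsInvariant G where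
  map_mem g s hs := by
    refine ⟨hs.1.map, ?_⟩
    rintro a ha b hb -
    obtain ⟨x, hx, rfl⟩ := Finset.mem_map.1 (Finset.mem_coe.1 ha)
    obtain ⟨y, hy, rfl⟩ := Finset.mem_map.1 (Finset.mem_coe.1 hb)
    exact (hs.2.total hx hy).imp (fun h => smul_mono_right g h) (fun h => smul_mono_right g h)

/-! ### Equivariant homotopy equivalence -/

/-- A map of `G`-spaces is `G`-equivariant. -/
def IsEquivariantMap (G : Type*) {X Y : Type*} [TopologicalSpace X] [TopologicalSpace Y]
    [SMul G X] [SMul G Y] (f : C(X, Y)) : Prop :=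
  ∀ (g : G) (x : X), f (g • x) = g • f x

/-- Two `G`-spaces are `G`-homotopy equivalent if there are `G`-equivariant continuous maps in both
directions whose composites are homotopic to the identity through `G`-equivariant maps. -/
def EquivariantlyHomotopyEquivalent (G X Y : Type*) [TopologicalSpace X] [TopologicalSpace Y]
    [Group G] [MulAction G X] [MulAction G Y] : Prop :=
  ∃ (f : C(X, Y)) (h : C(Y, X)), IsEquivariantMap G f ∧ IsEquivariantMap G h ∧
    (h.comp f).HomotopicWith (ContinuousMap.id X) (IsEquivariantMap G) ∧
    (f.comp h).HomotopicWith (ContinuousMap.id Y) (IsEquivariantMap G)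

/-! ### The common basis complex and partial direct sum decompositions -/

section Module

variable (R : Type*) [CommRing R] {M : Type*} [AddCommGroup M] [Module R M]

/-- The subset `B` of `M` is a basis of the submodule `N`. -/
def IsBasisOf (B : Set M) (N : Submodule R M) : Prop :=
  LinearIndepOn R id B ∧ Submodule.span R B = N

/-- `N` is a proper non-zero free direct summand of `M`. -/
def IsProperFreeSummand (N : Submodule R M) : Prop :=
  N ≠ ⊥ ∧ N ≠ ⊤ ∧ IsComplemented N ∧ Module.Free R N

variable (M) in
/-- The common basis complex of `M`: a non-empty finite set of proper non-zero free summands of `M`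
is a simplex if some basis `B` of `M` contains a basis of each of them. -/
def commonBasisComplex : PreAbstractSimplicialComplex (Submodule R M) where
  faces := {σ | σ.Nonempty ∧ (∀ N ∈ σ, IsProperFreeSummand R N) ∧
    ∃ B : Set M, IsBasisOf R B ⊤ ∧ ∀ N ∈ σ, ∃ C ⊆ B, IsBasisOf R C N}
  isRelLowerSet_faces := by
    rintro σ ⟨hne, hσ, B, hB, hBσ⟩
    exact ⟨hne, fun τ hτσ hτ =>
      ⟨hτ, fun N hN => hσ N (hτσ hN), B, hB, fun N hN => hBσ N (hτσ hN)⟩⟩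

/-- `τ = {N₁, …, N_r}` is a full direct sum decomposition `M = N₁ ⊕ ⋯ ⊕ N_r` of `M` into non-zero
free submodules. -/
structure IsFreeDecomposition (τ : Set (Submodule R M)) : Prop where
  finite : τ.Finite
  ne_bot : ∀ N ∈ τ, N ≠ ⊥
  free : ∀ N ∈ τ, Module.Free R N
  indep : sSupIndep τ
  sSup_eq_top : sSup τ = ⊤

variable (M) in
/-- A partial direct sum decomposition of `M`: a subset of a full direct sum decomposition of `M`
into non-zero free summands. -/
@[ext]
structure PartialDecomposition where
  /-- the summands -/
  parts : Set (Submodule R M)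
  exists_decomposition : ∃ τ, IsFreeDecomposition R τ ∧ parts ⊆ τ

variable {R}

theorem IsFreeDecomposition.eq_of_le {τ : Set (Submodule R M)} (hτ : IsFreeDecomposition R τ)
    {N N' : Submodule R M} (hN : N ∈ τ) (hN' : N' ∈ τ) (h : N ≤ N') : N = N' := by
  by_contra hne
  exact hτ.ne_bot N hN (disjoint_self.1 ((hτ.indep.pairwiseDisjoint hN hN' hne).mono_right h))

theorem PartialDecomposition.eq_of_le (σ : PartialDecomposition R M)
    {N N' : Submodule R M} (hN : N ∈ σ.parts) (hN' : N' ∈ σ.parts) (h : N ≤ N') : N = N' := by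
  obtain ⟨τ, hτ, hσ⟩ := σ.exists_decomposition
  exact hτ.eq_of_le (hσ hN) (hσ hN') h

theorem PartialDecomposition.parts_subset {σ σ' : PartialDecomposition R M}
    (h : ∀ N ∈ σ.parts, ∃ N' ∈ σ'.parts, N ≤ N') (h' : ∀ N ∈ σ'.parts, ∃ N' ∈ σ.parts, N ≤ N') :
    σ.parts ⊆ σ'.parts := by
  intro N hN
  obtain ⟨N', hN', hle⟩ := h N hN
  obtain ⟨N'', hN'', hle'⟩ := h' N' hN'
  have := σ.eq_of_le hN hN'' (hle.trans hle')
  subst this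
  rwa [le_antisymm hle hle']

/-- Partial decompositions are ordered by refinement. -/
instance PartialDecomposition.instPartialOrder : PartialOrder (PartialDecomposition R M) where
  le σ σ' := ∀ N ∈ σ.parts, ∃ N' ∈ σ'.parts, N ≤ N'
  le_refl _ N hN := ⟨N, hN, le_rfl⟩
  le_trans _ _ _ h h' N hN := by
    obtain ⟨N', hN', hle⟩ := h N hN
    obtain ⟨N'', hN'', hle'⟩ := h' N' hN'
    exact ⟨N'', hN'', hle.trans hle'⟩
  le_antisymm _ _ h h' := PartialDecomposition.ext
    (Set.Subset.antisymm (PartialDecomposition.parts_subset h h')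
      (PartialDecomposition.parts_subset h' h))

variable (R M) in
/-- The proper part `PD(M) \ {∅, {M}}` of the poset of partial decompositions. -/
abbrev ProperPartialDecomposition : Type _ :=
  {σ : PartialDecomposition R M // σ.parts ≠ ∅ ∧ σ.parts ≠ {⊤}}

end Module

/-! ### The actions of a group of linear automorphisms -/

section Action

variable {R : Type*} [CommRing R] {M : Type*} [AddCommGroup M] [Module R M]
  {G : Type*} [Group G] [DistribMulAction G M] [SMulCommClass G R M]

/-- `g` as a linear automorphism of `M`. -/
def smulLinearEquiv (R : Type*) [CommRing R] {M : Type*} [AddCommGroup M] [Module R M]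
    {G : Type*} [Group G] [DistribMulAction G M] [SMulCommClass G R M] (g : G) : M ≃ₗ[R] M :=
  DistribMulAction.toLinearEquiv R M g

/-- The action on submodules, `g • N = g(N)`. -/
instance submoduleMulAction : MulAction G (Submodule R M) where
  smul g N := N.map (smulLinearEquiv R g : M ≃ₗ[R] M).toLinearMap
  one_smul N := by
    ext x
    constructor
    · rintro ⟨y, hy, rfl⟩
      change (1 : G) • y ∈ N
      rwa [one_smul]
    · exact fun hx => ⟨x, hx, one_smul G x⟩
  mul_smul g h N := by
    ext x
    constructor
    · rintro ⟨y, hy, rfl⟩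
      exact ⟨h • y, ⟨y, hy, rfl⟩, (mul_smul g h y).symm⟩
    · rintro ⟨_, ⟨y, hy, rfl⟩, rfl⟩
      exact ⟨y, hy, mul_smul g h y⟩

theorem smul_eq_map (g : G) (N : Submodule R M) :
    g • N = N.map (smulLinearEquiv R g : M ≃ₗ[R] M).toLinearMap := rfl

theorem smul_eq_orderIso (g : G) (N : Submodule R M) :
    g • N = Submodule.orderIsoMapComap (smulLinearEquiv R g) N := rfl

theorem IsBasisOf.smul {B : Set M} {N : Submodule R M} (h : IsBasisOf R B N) (g : G) :
    IsBasisOf R ((g • ·) '' B) (g • N) := by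
  have himage : (g • ·) '' B = (smulLinearEquiv R g : M ≃ₗ[R] M).toLinearMap '' B := rfl
  refine ⟨?_, ?_⟩
  · rw [himage]
    exact LinearIndepOn.id_image
      (LinearIndependent.map' h.1 (smulLinearEquiv R g : M ≃ₗ[R] M).toLinearMap
        (LinearEquiv.ker _))
  · rw [himage, Submodule.span_image, h.2]
    rfl

theorem smul_free (g : G) {N : Submodule R M} (h : Module.Free R N) :
    Module.Free R (g • N : Submodule R M) :=
  Module.Free.of_equiv ((smulLinearEquiv R g).submoduleMap N)

theorem smul_ne_bot (g : G) {N : Submodule R M} (h : N ≠ ⊥) : g • N ≠ ⊥ := by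
  rw [smul_eq_orderIso, Ne, map_eq_bot_iff]
  exact h

theorem smul_ne_top (g : G) {N : Submodule R M} (h : N ≠ ⊤) : g • N ≠ ⊤ := by
  rw [smul_eq_orderIso, Ne, map_eq_top_iff]
  exact h

theorem smul_top (g : G) : g • (⊤ : Submodule R M) = ⊤ := by
  rw [smul_eq_orderIso, map_top]

theorem IsProperFreeSummand.smul {N : Submodule R M} (h : IsProperFreeSummand R N) (g : G) :
    IsProperFreeSummand R (g • N) := by
  refine ⟨smul_ne_bot g h.1, smul_ne_top g h.2.1, ?_, smul_free g h.2.2.2⟩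
  obtain ⟨Q, hQ⟩ := h.2.2.1
  exact ⟨g • Q, (OrderIso.isCompl_iff (Submodule.orderIsoMapComap (smulLinearEquiv R g))).1 hQ⟩

instance commonBasisComplex_isInvariant : (commonBasisComplex R M).IsInvariant G where
  map_mem g σ hσ := by
    obtain ⟨hne, hσ, B, hB, hBσ⟩ := hσ
    refine ⟨hne.map, ?_, (g • ·) '' B, ?_, ?_⟩
    · intro N hN
      obtain ⟨N', hN', rfl⟩ := Finset.mem_map.1 hN
      exact (hσ N' hN').smul g
    · have := hB.smul g
      rwa [smul_top] at this
    · intro N hN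
      obtain ⟨N', hN', rfl⟩ := Finset.mem_map.1 hN
      obtain ⟨C, hCB, hC⟩ := hBσ N' hN'
      exact ⟨(g • ·) '' C, Set.image_mono hCB, hC.smul g⟩

theorem IsFreeDecomposition.smul {τ : Set (Submodule R M)} (h : IsFreeDecomposition R τ) (g : G) :
    IsFreeDecomposition R ((g • ·) '' τ) where
  finite := h.finite.image _
  ne_bot := by
    rintro _ ⟨N, hN, rfl⟩
    exact smul_ne_bot g (h.ne_bot N hN)
  free := by
    rintro _ ⟨N, hN, rfl⟩
    exact smul_free g (h.free N hN)
  indep := by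
    have h1 := iSupIndep.map_orderIso (Submodule.orderIsoMapComap (smulLinearEquiv R g))
      ((sSupIndep_iff τ).1 h.indep)
    have h2 := h1.sSupIndep_range
    convert h2 using 1
    ext N
    simp [smul_eq_orderIso]
  sSup_eq_top := by
    have h1 := congrArg (Submodule.orderIsoMapComap (smulLinearEquiv R g)) h.sSup_eq_top
    rw [map_top, OrderIso.map_sSup] at h1
    rw [← h1, ← sSup_image]
    rfl

/-- The action on partial decompositions, `g • {N₁, …, N_k} = {g N₁, …, g N_k}`. -/
instance PartialDecomposition.instMulAction : MulAction G (PartialDecomposition R M) where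
  smul g σ :=
    { parts := (g • ·) '' σ.parts
      exists_decomposition := by
        obtain ⟨τ, hτ, hσ⟩ := σ.exists_decomposition
        exact ⟨(g • ·) '' τ, hτ.smul g, Set.image_mono hσ⟩ }
  one_smul σ := PartialDecomposition.ext (by
    change (fun N => (1 : G) • N) '' σ.parts = σ.parts
    simp)
  mul_smul g h σ := PartialDecomposition.ext (by
    change (fun N => (g * h) • N) '' σ.parts = (g • ·) '' ((h • ·) '' σ.parts)
    rw [Set.image_image]
    simp [mul_smul])

theorem PartialDecomposition.parts_smul (g : G) (σ : PartialDecomposition R M) :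
    (g • σ).parts = (g • ·) '' σ.parts := rfl

instance ProperPartialDecomposition.instMulAction :
    MulAction G (ProperPartialDecomposition R M) where
  smul g σ :=
    ⟨g • σ.1, by
      rw [PartialDecomposition.parts_smul]
      refine ⟨?_, fun h => ?_⟩
      · rw [Ne, Set.image_eq_empty]
        exact σ.2.1
      · apply σ.2.2
        have hinj : Function.Injective fun N : Submodule R M => g • N := MulAction.injective g
        apply hinj.image_injective
        change (g • ·) '' σ.1.parts = (g • ·) '' {⊤}
        rw [h, Set.image_singleton, smul_top]⟩
  one_smul σ := Subtype.ext (one_smul G σ.1)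
  mul_smul g h σ := Subtype.ext (mul_smul g h σ.1)

instance ProperPartialDecomposition.instCovariantClass :
    CovariantClass G (ProperPartialDecomposition R M) HSMul.hSMul LE.le where
  elim := by
    rintro g σ σ' h _ ⟨N, hN, rfl⟩
    obtain ⟨N', hN', hle⟩ := h N hN
    exact ⟨g • N', Set.mem_image_of_mem _ hN', Submodule.map_mono hle⟩

end Action

end

/-! In one direction, a partial decomposition σ goes to the simplex of its summands. This sends
simplices to simplices because a chain of partial decompositions admits a basis adapted to all the
summands that occur (`exists_adapted_basis`). Such a basis is built from the coarsest member of the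
chain inwards; what remains to be filled at each stage is stably free, hence free.

In the other direction, the proper non-zero intersections of members of a simplex s of the common
basis complex (`meets s`) are again spanned by parts of one basis, and the minimal ones are pairwise
disjoint, so they form a partial decomposition. This assignment is not order-reversing in s: for s ⊆
t, a minimal intersection of t need not lie in a minimal intersection of s. For a chain C of
simplices one therefore keeps only those minimal intersections of the largest simplex that lie below
a minimal intersection of every member (`chainDecomposition`). This set is non-empty and
order-reversing in C, so it gives a map after two barycentric subdivisions.

The composite on the common basis complex only involves summands in `meets` of the support of a
point. That set is a simplex containing the support, so a straight line joins the composite to the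
identity. For the other composite, naturality of subdivision reduces it to an order-reversing map on
chains of chains of partial decompositions. This map lies above C ↦ `chainMin (chainMax C)`
(`chainMin_chainMax_le`), which represents the identity after two subdivisions.

All homotopies come from contiguity. Subdivision is used only as an equivariant homotopy
equivalence, with `barycenter` as its inverse, and not as a homeomorphism. -/

noncomputable section

open scoped unitInterval

/-! ### Equivariant homotopies between realizations with the weak topology. -/

namespace PreAbstractSimplicialComplex

variable {V W : Type*} {K : PreAbstractSimplicialComplex V} {L : PreAbstractSimplicialComplex W}

/-! ### Continuity for the weak topology -/

/-- A closed simplex of the realization, as a space with its Euclidean topology. -/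
def ClosedSimplex (K : PreAbstractSimplicialComplex V) (s : Finset V) : Type _ :=
  K.closedSimplex s

instance (K : PreAbstractSimplicialComplex V) (s : Finset V) :
    TopologicalSpace (K.ClosedSimplex s) :=
  K.closedSimplexTopology s

theorem continuous_of_closedSimplex {Y : Type*} [TopologicalSpace Y] {F : K.Realization → Y}
    (h : ∀ s ∈ K.faces, Continuous fun x : K.ClosedSimplex s => F x.1) : Continuous F := by
  refine continuous_iSup_dom.2 fun s => continuous_coinduced_dom.2 ?_
  exact h s.1 s.2

theorem continuous_val_closedSimplex {s : Finset V} (hs : s ∈ K.faces) :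
    Continuous fun x : K.ClosedSimplex s => x.1 :=
  continuous_iff_coinduced_le.2
    (le_iSup (fun s : {s : Finset V // s ∈ K.faces} =>
      TopologicalSpace.coinduced Subtype.val (K.closedSimplexTopology s.1)) ⟨s, hs⟩)

theorem continuous_weight_closedSimplex (s : Finset V) (v : V) :
    Continuous fun x : K.ClosedSimplex s => x.1.weight v :=
  (continuous_apply v).comp
    (continuous_induced_dom (f := fun (x : K.closedSimplex s) (v : V) => x.1.weight v))

theorem continuous_weight (v : V) : Continuous fun x : K.Realization => x.weight v :=
  continuous_of_closedSimplex fun s _ => continuous_weight_closedSimplex s v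

/-- A point of the realization as a point of a closed simplex. -/
def ClosedSimplex.mk {s : Finset V} (x : K.Realization) (hx : x.weight.support ⊆ s) :
    K.ClosedSimplex s := ⟨x, hx⟩

theorem continuous_closedSimplex_mk {T : Type*} [TopologicalSpace T] {s : Finset V}
    {F : T → K.Realization} (hs : ∀ t, (F t).weight.support ⊆ s)
    (hF : ∀ v, Continuous fun t => (F t).weight v) :
    Continuous fun t => ClosedSimplex.mk (F t) (hs t) :=
  (continuous_induced_rng (f := fun (x : K.closedSimplex s) (v : V) => x.1.weight v)).2
    (continuous_pi hF)

/-- A map into the realization whose image meets only finitely many vertices is continuous as soon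
as its barycentric coordinates are. -/
theorem continuous_of_weight {T : Type*} [TopologicalSpace T] {F : T → L.Realization}
    (S : Finset W) (hS : ∀ t, (F t).weight.support ⊆ S)
    (hF : ∀ w, Continuous fun t => (F t).weight w) : Continuous F := by
  classical
  -- The faces inside `S` give a finite closed cover of `T`. On each piece the map factors through
  -- one closed simplex, where continuity is coordinatewise.
  let C : {s : Finset W // s ∈ S.powerset ∧ s ∈ L.faces} → Set T :=
    fun s => {t | (F t).weight.support ⊆ s.1}
  have : Finite {s : Finset W // s ∈ S.powerset ∧ s ∈ L.faces} :=
    (S.powerset.finite_toSet.subset fun s hs => hs.1 :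
      {s | s ∈ S.powerset ∧ s ∈ L.faces}.Finite).to_subtype
  refine (locallyFinite_of_finite C).continuous (Set.eq_univ_of_forall fun t => ?_) (fun s => ?_)
    fun s => ?_
  · exact Set.mem_iUnion.2 ⟨⟨(F t).weight.support, Finset.mem_powerset.2 (hS t),
      (F t).support_mem⟩, Finset.Subset.refl _⟩
  · have : C s = ⋂ w ∈ {w | w ∉ s.1}, {t | (F t).weight w = 0} := by
      ext t
      simp only [C, Set.mem_ofPred_eq, Set.mem_iInter, Finset.subset_iff, Finsupp.mem_support_iff]
      exact forall_congr' fun w => not_imp_comm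
    rw [this]
    exact isClosed_biInter fun w _ => isClosed_eq (hF w) continuous_const
  · rw [continuousOn_iff_continuous_domRestrict]
    exact (continuous_val_closedSimplex s.2.2).comp
      (continuous_closedSimplex_mk (F := fun t : C s => F t.1) (fun t => t.2)
        fun w => (hF w).comp continuous_subtype_val)

/-- Joint continuity of a homotopy may be checked on closed simplices. -/
theorem continuous_homotopy {F : I × K.Realization → L.Realization}
    (hcar : ∀ S : Finset V, ∃ T : Finset W, ∀ t x, x.weight.support ⊆ S →
      (F (t, x)).weight.support ⊆ T)
    (hF : ∀ S ∈ K.faces, ∀ w, Continuous fun p : K.ClosedSimplex S × I =>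
      (F (p.2, p.1.1)).weight w) : Continuous F := by
  have hS : ∀ S ∈ K.faces, Continuous fun p : K.ClosedSimplex S × I => F (p.2, p.1.1) := by
    intro S hS
    obtain ⟨T, hT⟩ := hcar S
    exact continuous_of_weight T (fun p => hT p.2 p.1.1 p.1.2) (hF S hS)
  have hx : ∀ x : K.Realization, Continuous fun t => F (t, x) := fun x =>
    (hS _ x.support_mem).comp
      ((continuous_const (y := ClosedSimplex.mk x (Finset.Subset.refl _))).prodMk continuous_id)
  -- The weak topology controls maps out of the realization, not out of its product with the
  -- interval. Currying removes the interval, and its local compactness allows uncurrying at the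
  -- end.
  let F' : K.Realization → C(I, L.Realization) := fun x => ⟨fun t => F (t, x), hx x⟩
  have hF' : Continuous F' := continuous_of_closedSimplex fun S hS' =>
    ContinuousMap.continuous_of_continuous_uncurry _ (hS S hS')
  exact (ContinuousMap.continuous_uncurry_of_continuous ⟨F', hF'⟩).comp continuous_swap

theorem mem_faces_of_subset {s t : Finset V} (hs : s ∈ K.faces) (hts : t ⊆ s) (ht : t.Nonempty) :
    t ∈ K.faces :=
  (K.isRelLowerSet_faces hs).2 hts ht

theorem nonempty_of_mem_faces {s : Finset V} (hs : s ∈ K.faces) : s.Nonempty :=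
  (K.isRelLowerSet_faces hs).1

namespace Realization

theorem support_nonempty (x : K.Realization) : x.weight.support.Nonempty :=
  nonempty_of_mem_faces x.support_mem

theorem weight_pos {x : K.Realization} {v : V} (hv : v ∈ x.weight.support) : 0 < x.weight v :=
  lt_of_le_of_ne (x.nonneg v) (Ne.symm (Finsupp.mem_support_iff.1 hv))

/-- The point of the realization with given barycentric coordinates supported in a face. -/
def ofSubset (a : V →₀ ℝ) (h0 : ∀ v, 0 ≤ a v) (h1 : (a.sum fun _ r => r) = 1)
    (hs : ∃ s ∈ K.faces, a.support ⊆ s) : K.Realization where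
  weight := a
  nonneg := h0
  sum_eq_one := h1
  support_mem := by
    obtain ⟨s, hs, has⟩ := hs
    refine mem_faces_of_subset hs has (Finset.nonempty_iff_ne_empty.2 fun h => ?_)
    rw [Finsupp.support_eq_empty] at h
    simp [h] at h1

end Realization

/-! ### Equivariant maps between realizations -/

section Equivariant

variable {G : Type*} [Group G] [MulAction G V] [MulAction G W]

@[simp]
theorem smul_weight_smul [K.IsInvariant G] (g : G) (x : K.Realization) (v : V) :
    (g • x).weight (g • v) = x.weight v :=
  Finsupp.embDomain_apply_self (MulAction.toPerm g).toEmbedding x.weight v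

theorem support_smul [K.IsInvariant G] (g : G) (x : K.Realization) :
    (g • x).weight.support = x.weight.support.map (MulAction.toPerm g).toEmbedding :=
  Finsupp.support_embDomain _ _

end Equivariant

/-- An equivariant continuous map between realizations that maps every closed simplex into a finite
subcomplex. -/
structure GMap (G : Type*) [Group G] [MulAction G V] [MulAction G W]
    (K : PreAbstractSimplicialComplex V) [K.IsInvariant G]
    (L : PreAbstractSimplicialComplex W) [L.IsInvariant G] extends
    C(K.Realization, L.Realization) where
  carried : ∀ S : Finset V, ∃ T : Finset W, ∀ x : K.Realization, x.weight.support ⊆ S →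
    (toFun x).weight.support ⊆ T
  equivariant : IsEquivariantMap G toContinuousMap

namespace GMap

variable {V' : Type*} {K' : PreAbstractSimplicialComplex V'}
variable {G : Type*} [Group G] [MulAction G V] [MulAction G W] [MulAction G V']
  [K.IsInvariant G] [L.IsInvariant G] [K'.IsInvariant G]

instance : CoeFun (GMap G K L) fun _ => K.Realization → L.Realization := ⟨fun f => f.toFun⟩

theorem map_smul (f : GMap G K L) (g : G) (x : K.Realization) : f (g • x) = g • f x :=
  f.equivariant g x

variable (G K) in
/-- The identity map. -/
protected def id : GMap G K K where
  toContinuousMap := ContinuousMap.id _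
  carried S := ⟨S, fun _ h => h⟩
  equivariant _ _ := rfl

/-- Composition of maps. -/
def comp (f' : GMap G L K') (f : GMap G K L) : GMap G K K' where
  toContinuousMap := f'.toContinuousMap.comp f.toContinuousMap
  carried S := by
    obtain ⟨T, hT⟩ := f.carried S
    obtain ⟨U, hU⟩ := f'.carried T
    exact ⟨U, fun x hx => hU _ (hT x hx)⟩
  equivariant g x := by
    change f' (f (g • x)) = g • f' (f x)
    rw [f.map_smul, f'.map_smul]

/-- Two equivariant maps are homotopic if they are so through equivariant maps. -/
def Homotopic (f f' : GMap G K L) : Prop :=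
  f.toContinuousMap.HomotopicWith f'.toContinuousMap (IsEquivariantMap G)

namespace Homotopic

theorem refl (f : GMap G K L) : f.Homotopic f :=
  ContinuousMap.HomotopicWith.refl _ f.equivariant

theorem symm {f f' : GMap G K L} (h : f.Homotopic f') : f'.Homotopic f :=
  ContinuousMap.HomotopicWith.symm h

theorem trans {f f' f'' : GMap G K L} (h : f.Homotopic f') (h' : f'.Homotopic f'') :
    f.Homotopic f'' :=
  ContinuousMap.HomotopicWith.trans h h'

theorem comp_left (f : GMap G L K') {f₁ f₂ : GMap G K L} (h : f₁.Homotopic f₂) :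
    (f.comp f₁).Homotopic (f.comp f₂) := by
  obtain ⟨H⟩ := h
  exact ⟨{ toFun := fun p => f (H p)
           continuous_toFun := f.continuous_toFun.comp H.continuous_toFun
           map_zero_left := fun x => congrArg f (H.map_zero_left x)
           map_one_left := fun x => congrArg f (H.map_one_left x)
           prop' := fun t g x => (congrArg f (H.prop' t g x)).trans (f.map_smul g _) }⟩

theorem comp_right {f₁ f₂ : GMap G L K'} (h : f₁.Homotopic f₂) (f : GMap G K L) :
    (f₁.comp f).Homotopic (f₂.comp f) := by
  obtain ⟨H⟩ := h
  exact ⟨{ toFun := fun p => H (p.1, f p.2)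
           continuous_toFun := H.continuous_toFun.comp
            (continuous_fst.prodMk (f.continuous_toFun.comp continuous_snd))
           map_zero_left := fun x => H.map_zero_left (f x)
           map_one_left := fun x => H.map_one_left (f x)
           prop' := fun t g x => (congrArg (fun y => H (t, y)) (f.map_smul g x)).trans
            (H.prop' t g (f x)) }⟩

/-- Contiguous maps are homotopic by the straight-line homotopy. -/
theorem of_contiguous {f f' : GMap G K L}
    (h : ∀ x, ∃ s ∈ L.faces, (f x).weight.support ⊆ s ∧ (f' x).weight.support ⊆ s) :
    f.Homotopic f' := by
  classical
  let H : I × K.Realization → L.Realization := fun p =>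
    Realization.ofSubset
      ((1 - (p.1 : ℝ)) • (f p.2).weight + (p.1 : ℝ) • (f' p.2).weight)
      (fun w => by
        have h1 := mul_nonneg (sub_nonneg.2 p.1.2.2) ((f p.2).nonneg w)
        have h2 := mul_nonneg p.1.2.1 ((f' p.2).nonneg w)
        simpa using add_nonneg h1 h2)
      (by
        rw [Finsupp.sum_add_index' (fun _ => rfl) (fun _ _ _ => rfl),
          Finsupp.sum_smul_index (fun _ => rfl), Finsupp.sum_smul_index (fun _ => rfl),
          ← Finsupp.mul_sum, ← Finsupp.mul_sum, (f p.2).sum_eq_one, (f' p.2).sum_eq_one]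
        ring)
      (by
        obtain ⟨s, hs, h1, h2⟩ := h p.2
        exact ⟨s, hs, Finsupp.support_add.trans (Finset.union_subset
          (Finsupp.support_smul.trans h1) (Finsupp.support_smul.trans h2))⟩)
  have hH : ∀ p w, (H p).weight w =
      (1 - (p.1 : ℝ)) * (f p.2).weight w + (p.1 : ℝ) * (f' p.2).weight w := fun p w => by
    simp [H, Realization.ofSubset]
  refine ⟨{ toFun := H
            continuous_toFun := continuous_homotopy (fun S => ?_) fun S hS w => ?_
            map_zero_left := fun x => Realization.ext (Finsupp.ext fun w => ?_)
            map_one_left := fun x => Realization.ext (Finsupp.ext fun w => ?_)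
            prop' := fun t g x => Realization.ext (Finsupp.ext fun w => ?_) }⟩
  · obtain ⟨T, hT⟩ := f.carried S
    obtain ⟨T', hT'⟩ := f'.carried S
    -- The finite carriers of both maps keep the straight-line homotopy in finitely many vertices
    -- over each closed simplex, so continuity is only a question about coordinates.
    exact ⟨T ∪ T', fun t x hx => Finsupp.support_add.trans (Finset.union_subset_union
      (Finsupp.support_smul.trans (hT x hx)) (Finsupp.support_smul.trans (hT' x hx)))⟩
  · simp only [hH]
    have h0 : Continuous fun p : K.ClosedSimplex S × I => p.1.1 :=
      (continuous_val_closedSimplex hS).comp continuous_fst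
    have h1 : Continuous fun p : K.ClosedSimplex S × I => (f p.1.1).weight w :=
      (continuous_weight w).comp (f.continuous_toFun.comp h0)
    have h2 : Continuous fun p : K.ClosedSimplex S × I => (f' p.1.1).weight w :=
      (continuous_weight w).comp (f'.continuous_toFun.comp h0)
    have h3 : Continuous fun p : K.ClosedSimplex S × I => (p.2 : ℝ) :=
      continuous_subtype_val.comp continuous_snd
    exact ((continuous_const.sub h3).mul h1).add (h3.mul h2)
  · rw [hH]
    simp
  · rw [hH]
    simp
  · obtain ⟨v, rfl⟩ := MulAction.surjective g w
    change (H (t, g • x)).weight (g • v) = (g • H (t, x)).weight (g • v)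
    rw [smul_weight_smul, hH, hH]
    simp only [map_smul, smul_weight_smul]

end Homotopic

end GMap

/-! ### Maps given by unnormalized barycentric coordinates -/

/-- Equivariant families of unnormalized barycentric coordinates. -/
structure CoordinateFamily (G : Type*) [Group G] [MulAction G V] [MulAction G W]
    (K : PreAbstractSimplicialComplex V) [K.IsInvariant G]
    (L : PreAbstractSimplicialComplex W) where
  /-- the coordinates -/
  coord : K.Realization → W →₀ ℝ
  nonneg : ∀ x w, 0 ≤ coord x w
  support_mem : ∀ x, (coord x).support ∈ L.faces
  carried : ∀ S : Finset V, ∃ T : Finset W, ∀ x : K.Realization, x.weight.support ⊆ S →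
    (coord x).support ⊆ T
  continuous : ∀ S ∈ K.faces, ∀ w, Continuous fun x : K.ClosedSimplex S => coord x.1 w
  coord_smul : ∀ (g : G) x w, coord (g • x) (g • w) = coord x w

namespace CoordinateFamily

variable {G : Type*} [Group G] [MulAction G V] [MulAction G W]
  [K.IsInvariant G] (c : CoordinateFamily G K L)

/-- The sum of the coordinates. -/
def total (x : K.Realization) : ℝ := (c.coord x).sum fun _ a => a

theorem total_pos (x : K.Realization) : 0 < c.total x :=
  Finset.sum_pos (fun w hw => lt_of_le_of_ne (c.nonneg x w)
    (Ne.symm (Finsupp.mem_support_iff.1 hw))) (nonempty_of_mem_faces (c.support_mem x))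

theorem total_smul (g : G) (x : K.Realization) : c.total (g • x) = c.total x := by
  have : c.coord (g • x) = (c.coord x).embDomain (MulAction.toPerm g).toEmbedding := by
    ext w
    obtain ⟨v, rfl⟩ := MulAction.surjective g w
    rw [c.coord_smul]
    exact (Finsupp.embDomain_apply_self (MulAction.toPerm g).toEmbedding _ v).symm
  rw [total, this, Finsupp.sum_embDomain]
  rfl

theorem continuous_total {S : Finset V} (hS : S ∈ K.faces) :
    Continuous fun x : K.ClosedSimplex S => c.total x.1 := by
  obtain ⟨T, hT⟩ := c.carried S
  have : (fun x : K.ClosedSimplex S => c.total x.1) = fun x => ∑ w ∈ T, c.coord x.1 w :=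
    funext fun x => Finsupp.sum_of_support_subset _ (hT x.1 x.2) _ fun _ _ => rfl
  rw [this]
  exact continuous_finsetSum _ fun w _ => c.continuous S hS w

/-- The point with the normalized coordinates. -/
def normalize (x : K.Realization) : L.Realization :=
  Realization.ofSubset ((c.total x)⁻¹ • c.coord x)
    (fun w => mul_nonneg (inv_nonneg.2 (c.total_pos x).le) (c.nonneg x w))
    (by
      rw [Finsupp.sum_smul_index (fun _ => rfl), ← Finsupp.mul_sum]
      exact inv_mul_cancel₀ (c.total_pos x).ne')
    ⟨_, c.support_mem x, Finsupp.support_smul⟩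

theorem normalize_weight (x : K.Realization) (w : W) :
    (c.normalize x).weight w = (c.total x)⁻¹ * c.coord x w := rfl

theorem support_normalize (x : K.Realization) :
    (c.normalize x).weight.support = (c.coord x).support := by
  ext w
  simp [normalize_weight, (c.total_pos x).ne']

/-- The map of realizations defined by a family of coordinates. -/
def toGMap [L.IsInvariant G] : GMap G K L where
  toFun := c.normalize
  continuous_toFun := by
    refine continuous_of_closedSimplex fun S hS => ?_
    obtain ⟨T, hT⟩ := c.carried S
    refine continuous_of_weight T (fun x => ?_) fun w => ?_
    · rw [support_normalize]
      exact hT x.1 x.2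
    · simp only [normalize_weight]
      exact ((c.continuous_total hS).inv₀ fun x => (c.total_pos x.1).ne').mul
        (c.continuous S hS w)
  carried S := by
    obtain ⟨T, hT⟩ := c.carried S
    refine ⟨T, fun x hx => ?_⟩
    rw [support_normalize]
    exact hT x hx
  equivariant g x := Realization.ext (Finsupp.ext fun w => by
    obtain ⟨v, rfl⟩ := MulAction.surjective g w
    change (c.normalize (g • x)).weight (g • v) = (g • c.normalize x).weight (g • v)
    rw [smul_weight_smul, normalize_weight, normalize_weight, total_smul, c.coord_smul])

theorem support_toGMap [L.IsInvariant G] (x : K.Realization) :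
    (c.toGMap x).weight.support = (c.coord x).support :=
  c.support_normalize x

end CoordinateFamily

end PreAbstractSimplicialComplex
end

noncomputable section

open scoped unitInterval

/-! ### Carriers, barycentric subdivision and order complexes up to equivariant homotopy. -/

namespace PreAbstractSimplicialComplex

section Subdivision

open scoped Classical

variable {V W : Type*} {K : PreAbstractSimplicialComplex V} {L : PreAbstractSimplicialComplex W}

/-! ### Carriers -/

/-- An equivariant assignment of a finite set of vertices to every vertex that carries simplices to
simplices. -/
structure Carrier (G : Type*) [Group G] [MulAction G V] [MulAction G W]
    (K : PreAbstractSimplicialComplex V) (L : PreAbstractSimplicialComplex W) where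
  /-- the set of vertices assigned to a vertex -/
  toFun : V → Finset W
  biUnion_mem : ∀ s ∈ K.faces, s.biUnion toFun ∈ L.faces
  smul_mem : ∀ (g : G) v w, w ∈ toFun v → g • w ∈ toFun (g • v)

namespace Carrier

variable {G : Type*} [Group G] [MulAction G V] [MulAction G W] (r : Carrier G K L)

theorem smul_mem_iff (g : G) (v : V) (w : W) : g • w ∈ r.toFun (g • v) ↔ w ∈ r.toFun v :=
  ⟨fun h => by simpa using r.smul_mem g⁻¹ _ _ h, r.smul_mem g v w⟩

/-- The sum of the weights of the vertices whose carrier contains `w`. -/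
def mass (x : K.Realization) (w : W) : ℝ :=
  ∑ v ∈ x.weight.support, if w ∈ r.toFun v then x.weight v else 0

theorem mass_eq {x : K.Realization} {S : Finset V} (hS : x.weight.support ⊆ S) (w : W) :
    r.mass x w = ∑ v ∈ S, if w ∈ r.toFun v then x.weight v else 0 :=
  Finset.sum_subset hS fun v _ hv => by simp [Finsupp.notMem_support_iff.1 hv]

theorem mass_term_nonneg (x : K.Realization) (w : W) (v : V) :
    0 ≤ if w ∈ r.toFun v then x.weight v else 0 := by
  split_ifs
  exacts [x.nonneg v, le_rfl]

theorem mass_nonneg (x : K.Realization) (w : W) : 0 ≤ r.mass x w :=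
  Finset.sum_nonneg fun v _ => r.mass_term_nonneg x w v

theorem mass_ne_zero_iff (x : K.Realization) (w : W) :
    r.mass x w ≠ 0 ↔ w ∈ x.weight.support.biUnion r.toFun := by
  rw [mass, Ne, Finset.sum_eq_zero_iff_of_nonneg fun v _ => r.mass_term_nonneg x w v]
  simp only [Finset.mem_biUnion, Finsupp.mem_support_iff]
  push Not
  refine exists_congr fun v => ⟨fun h => ⟨h.1, ?_⟩, fun h => ⟨h.1, ?_⟩⟩
  · by_contra hw
    simp [hw] at h
  · rw [if_pos h.2]
    exact h.1

variable [K.IsInvariant G]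

theorem mass_smul (g : G) (x : K.Realization) (w : W) : r.mass (g • x) (g • w) = r.mass x w := by
  rw [mass, support_smul, Finset.sum_map]
  refine Finset.sum_congr rfl fun v _ => ?_
  change (if g • w ∈ r.toFun (g • v) then (g • x).weight (g • v) else 0) = _
  simp only [smul_mem_iff, smul_weight_smul]

/-- The coordinates of the map defined by a carrier. -/
def coordinateFamily : CoordinateFamily G K L where
  coord x := Finsupp.onFinset (x.weight.support.biUnion r.toFun) (r.mass x)
    fun w => (r.mass_ne_zero_iff x w).1
  nonneg := r.mass_nonneg
  support_mem x := by
    convert r.biUnion_mem _ x.support_mem using 1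
    ext w
    rw [Finsupp.mem_support_onFinset, mass_ne_zero_iff]
  carried S := ⟨S.biUnion r.toFun, fun x hx =>
    Finsupp.support_onFinset_subset.trans (Finset.biUnion_subset_biUnion_of_subset_left _ hx)⟩
  continuous S hS w := by
    simp only [Finsupp.onFinset_apply]
    have : (fun x : K.ClosedSimplex S => r.mass x.1 w) =
        fun x => ∑ v ∈ S, if w ∈ r.toFun v then x.1.weight v else 0 :=
      funext fun x => r.mass_eq x.2 w
    rw [this]
    refine continuous_finsetSum _ fun v _ => ?_
    split_ifs
    exacts [continuous_weight_closedSimplex S v, continuous_const]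
  coord_smul := r.mass_smul

variable [L.IsInvariant G]

/-- The map of realizations defined by a carrier. -/
def realize : GMap G K L := r.coordinateFamily.toGMap

theorem support_realize (x : K.Realization) :
    (r.realize x).weight.support = x.weight.support.biUnion r.toFun := by
  rw [realize, CoordinateFamily.support_toGMap]
  ext w
  exact (Finsupp.mem_support_onFinset fun w => (r.mass_ne_zero_iff x w).1).trans
    (r.mass_ne_zero_iff x w)

/-- Normalization divides all masses by the same positive number, so superlevel sets can be read off
from the masses. -/
theorem realize_lt_realize (x : K.Realization) {w w' : W} :
    (r.realize x).weight w < (r.realize x).weight w' ↔ r.mass x w < r.mass x w' :=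
  mul_lt_mul_iff_right₀ (inv_pos.2 (r.coordinateFamily.total_pos x))

end Carrier

/-! ### Barycentric subdivision -/

/-- The simplices of a simplicial complex, ordered by inclusion. -/
abbrev Face (K : PreAbstractSimplicialComplex V) : Type _ := {s : Finset V // s ∈ K.faces}

instance (G : Type*) [Group G] [MulAction G V] [K.IsInvariant G] : MulAction G K.Face where
  smul g s := ⟨s.1.map (MulAction.toPerm g).toEmbedding, IsInvariant.map_mem g s.1 s.2⟩
  one_smul s := Subtype.ext (Finset.ext fun v => by
    change v ∈ s.1.map (MulAction.toPerm (1 : G)).toEmbedding ↔ v ∈ s.1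
    simp)
  mul_smul g h s := Subtype.ext (Finset.ext fun v => by
    change v ∈ s.1.map (MulAction.toPerm (g * h)).toEmbedding ↔
      v ∈ (s.1.map (MulAction.toPerm h).toEmbedding).map (MulAction.toPerm g).toEmbedding
    simp [mul_smul])

variable {G : Type*} [Group G] [MulAction G V] [MulAction G W]

theorem Face.coe_smul [K.IsInvariant G] (g : G) (s : K.Face) :
    (g • s).1 = s.1.map (MulAction.toPerm g).toEmbedding := rfl

theorem Face.mem_smul_iff [K.IsInvariant G] {g : G} {s : K.Face} {v : V} :
    v ∈ (g • s).1 ↔ ∃ w ∈ s.1, g • w = v :=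
  Finset.mem_map

@[simp]
theorem Face.smul_mem_smul_iff [K.IsInvariant G] {g : G} {s : K.Face} {v : V} :
    g • v ∈ (g • s).1 ↔ v ∈ s.1 := by
  simp [Face.mem_smul_iff]

instance [K.IsInvariant G] : CovariantClass G K.Face HSMul.hSMul LE.le where
  elim _ _ _ h := Finset.map_subset_map.2 h

theorem Face.nonempty (s : K.Face) : s.1.Nonempty := nonempty_of_mem_faces s.2

/-- The amount by which the weights on the face `s` exceed all other weights. -/
def gap (x : K.Realization) (S : Finset V) (s : K.Face) : NNReal :=
  s.1.inf' s.nonempty (fun v => (x.weight v).toNNReal) -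
    (S \ s.1).sup fun v => (x.weight v).toNNReal

/-- Vertices outside the support have weight zero and do not change the supremum. A fixed `S` can
thus replace the varying support when continuity is checked on a closed simplex. -/
theorem gap_eq {x : K.Realization} {S : Finset V} (hS : x.weight.support ⊆ S) (s : K.Face) :
    gap x x.weight.support s = gap x S s := by
  rw [gap, gap]
  congr 1
  refine le_antisymm (Finset.sup_mono (Finset.sdiff_subset_sdiff hS (Finset.Subset.refl _)))
    (Finset.sup_le fun v hv => ?_)
  by_cases hv' : v ∈ x.weight.support
  · exact Finset.le_sup (f := fun v => (x.weight v).toNNReal)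
      (Finset.mem_sdiff.2 ⟨hv', (Finset.mem_sdiff.1 hv).2⟩)
  · simp [Finsupp.notMem_support_iff.1 hv']

/-- Truncated subtraction leaves something positive exactly when `s` is a superlevel set of the
weights at a positive level. These are the faces occurring in the flag of the subdivision that
contains `x`. -/
theorem gap_ne_zero_iff (x : K.Realization) (s : K.Face) :
    gap x x.weight.support s ≠ 0 ↔
      ∀ v ∈ s.1, 0 < x.weight v ∧ ∀ w ∉ s.1, x.weight w < x.weight v := by
  rw [← pos_iff_ne_zero, gap, tsub_pos_iff_lt, Finset.lt_inf'_iff]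
  refine forall₂_congr fun v hv => ⟨fun h => ?_, fun h => ?_⟩
  · have hpos : 0 < x.weight v := Real.toNNReal_pos.1 (bot_le.trans_lt h)
    refine ⟨hpos, fun w hw => ?_⟩
    by_cases hw' : w ∈ x.weight.support
    · exact (Real.toNNReal_lt_toNNReal_iff hpos).1 ((Finset.le_sup
        (f := fun v => (x.weight v).toNNReal) (Finset.mem_sdiff.2 ⟨hw', hw⟩)).trans_lt h)
    · rwa [Finsupp.notMem_support_iff.1 hw']
  · refine (Finset.sup_lt_iff (Real.toNNReal_pos.2 h.1)).2 fun w hw => ?_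
    exact (Real.toNNReal_lt_toNNReal_iff h.1).2 (h.2 w (Finset.mem_sdiff.1 hw).2)

theorem gap_smul [K.IsInvariant G] (g : G) (x : K.Realization) (s : K.Face) :
    gap (g • x) (g • x).weight.support (g • s) = gap x x.weight.support s := by
  have h : ∀ v, ((g • x).weight ((MulAction.toPerm g).toEmbedding v)) = x.weight v :=
    fun v => smul_weight_smul g x v
  simp only [gap, support_smul, Face.coe_smul, ← Finset.map_sdiff, Finset.sup_map, Finset.inf'_map,
    Function.comp_def, h]

/-- The faces contained in `S`. -/
def facesIn (K : PreAbstractSimplicialComplex V) (S : Finset V) : Finset K.Face :=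
  S.powerset.subtype (· ∈ K.faces)

theorem mem_facesIn {S : Finset V} {s : K.Face} : s ∈ K.facesIn S ↔ s.1 ⊆ S := by
  simp [facesIn]

theorem gap_support_subset (x : K.Realization) (s : K.Face)
    (h : gap x x.weight.support s ≠ 0) : s ∈ K.facesIn x.weight.support :=
  mem_facesIn.2 fun v hv =>
    Finsupp.mem_support_iff.2 (((gap_ne_zero_iff x s).1 h v hv).1.ne')

variable (G K) in
/-- The coordinates of the comparison map with the barycentric subdivision. -/
def subdivisionFamily [K.IsInvariant G] : CoordinateFamily G K (orderComplex K.Face) where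
  coord x := Finsupp.onFinset (K.facesIn x.weight.support)
    (fun s => (gap x x.weight.support s : ℝ))
    fun s hs => gap_support_subset x s (NNReal.coe_ne_zero.1 hs)
  nonneg x s := NNReal.coe_nonneg _
  support_mem x := by
    have hmem : ∀ s : K.Face, s ∈ (Finsupp.onFinset (K.facesIn x.weight.support)
        (fun s => (gap x x.weight.support s : ℝ))
        fun s hs => gap_support_subset x s (NNReal.coe_ne_zero.1 hs)).support ↔
        ∀ v ∈ s.1, 0 < x.weight v ∧ ∀ w ∉ s.1, x.weight w < x.weight v := fun s => by
      rw [Finsupp.mem_support_onFinset, NNReal.coe_ne_zero, gap_ne_zero_iff]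
    refine ⟨?_, fun s hs t ht _ => ?_⟩
    -- The vertices of maximal weight form a superlevel set, so not all coordinates vanish.
    · obtain ⟨m, hm, hmax⟩ := x.weight.support.exists_max_image x.weight x.support_nonempty
      have hsub : x.weight.support.filter (fun v => x.weight v = x.weight m) ⊆
        x.weight.support := Finset.filter_subset _ _
      refine ⟨⟨_, mem_faces_of_subset x.support_mem hsub ⟨m, by simpa using hm⟩⟩,
        (hmem _).2 fun v hv => ?_⟩
      rw [Finset.mem_filter] at hv
      rw [hv.2]
      refine ⟨Realization.weight_pos hm, fun w hw => ?_⟩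
      by_cases hw' : w ∈ x.weight.support
      · exact lt_of_le_of_ne (hmax w hw') fun h => hw (Finset.mem_filter.2 ⟨hw', h⟩)
      · rw [Finsupp.notMem_support_iff.1 hw']
        exact Realization.weight_pos hm
    -- Superlevel sets are nested: two vertices witnessing incomparability would each have strictly
    -- larger weight than the other.
    · by_contra hcon
      rw [not_or] at hcon
      obtain ⟨v, hv, hv'⟩ := Finset.not_subset.1 hcon.1
      obtain ⟨w, hw, hw'⟩ := Finset.not_subset.1 hcon.2
      exact lt_asymm (((hmem s).1 hs v hv).2 w hw') (((hmem t).1 ht w hw).2 v hv')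
  carried S := ⟨K.facesIn S, fun x hx s hs =>
    mem_facesIn.2 ((mem_facesIn.1 (Finsupp.support_onFinset_subset hs)).trans hx)⟩
  continuous S hS s := by
    simp only [Finsupp.onFinset_apply]
    have : (fun x : K.ClosedSimplex S => (gap x.1 x.1.weight.support s : ℝ)) =
        fun x => (gap x.1 S s : ℝ) := funext fun x => by rw [gap_eq x.2]
    rw [this]
    have hc : ∀ v, Continuous fun x : K.ClosedSimplex S => (x.1.weight v).toNNReal :=
      fun v => continuous_real_toNNReal.comp (continuous_weight_closedSimplex S v)
    exact NNReal.continuous_coe.comp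
      ((Continuous.finset_inf'_apply s.nonempty fun v _ => hc v).sub
        (Continuous.finset_sup_apply fun v _ => hc v))
  coord_smul g x s := congrArg NNReal.toReal (gap_smul g x s)

variable (G K) in
/-- The comparison map of a simplicial complex with its barycentric subdivision. -/
def subdivide [K.IsInvariant G] : GMap G K (orderComplex K.Face) :=
  (subdivisionFamily K G).toGMap

theorem mem_support_subdivide [K.IsInvariant G] (x : K.Realization) (s : K.Face) :
    s ∈ (subdivide K G x).weight.support ↔
      ∀ v ∈ s.1, 0 < x.weight v ∧ ∀ w ∉ s.1, x.weight w < x.weight v := by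
  rw [subdivide, CoordinateFamily.support_toGMap]
  exact (Finsupp.mem_support_onFinset fun s hs =>
    gap_support_subset x s (NNReal.coe_ne_zero.1 hs)).trans (NNReal.coe_ne_zero.trans (gap_ne_zero_iff x s))

theorem subset_of_mem_support_subdivide [K.IsInvariant G] {x : K.Realization} {s : K.Face}
    (hs : s ∈ (subdivide K G x).weight.support) : s.1 ⊆ x.weight.support := fun v hv =>
  Finsupp.mem_support_iff.2 (((mem_support_subdivide x s).1 hs v hv).1.ne')

theorem exists_isMax_of_isChain {P : Type*} [PartialOrder P] {c : Finset P}
    (hc : c ∈ (orderComplex P).faces) : ∃ m ∈ c, ∀ p ∈ c, p ≤ m := by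
  obtain ⟨m, hm⟩ := c.exists_maximal hc.1
  exact ⟨m, hm.1, fun p hp => (hc.2.total hp hm.1).elim id fun h => hm.2 hp h⟩

theorem exists_isMin_of_isChain {P : Type*} [PartialOrder P] {c : Finset P}
    (hc : c ∈ (orderComplex P).faces) : ∃ m ∈ c, ∀ p ∈ c, m ≤ p := by
  obtain ⟨m, hm⟩ := c.exists_minimal hc.1
  exact ⟨m, hm.1, fun p hp => (hc.2.total hp hm.1).elim (fun h => hm.2 hp h) id⟩

variable (K G) in
/-- Every simplex of the barycentric subdivision is carried to its barycenter. -/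
def barycenter [K.IsInvariant G] : Carrier G (orderComplex K.Face) K where
  toFun s := s.1
  biUnion_mem c hc := by
    obtain ⟨m, hm, hmax⟩ := exists_isMax_of_isChain hc
    have : c.biUnion (fun s => s.1) = m.1 := le_antisymm (Finset.biUnion_subset.2 hmax)
      (Finset.subset_biUnion_of_mem (fun s : K.Face => s.1) hm)
    rw [this]
    exact m.2
  smul_mem _ _ _ h := Face.smul_mem_smul_iff.2 h

/-- Superlevel sets lie in the support, so the composite keeps every point in its own closed
simplex. -/
theorem barycenter_comp_subdivide [K.IsInvariant G] :
    ((barycenter K G).realize.comp (subdivide K G)).Homotopic (GMap.id K G) := by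
  refine GMap.Homotopic.of_contiguous fun x => ⟨_, x.support_mem, ?_, Finset.Subset.refl _⟩
  change ((barycenter K G).realize (subdivide K G x)).weight.support ⊆ _
  rw [Carrier.support_realize]
  exact Finset.biUnion_subset.2 fun s hs => subset_of_mem_support_subdivide hs

/-- The mass of a vertex is the total weight of the chain members containing it, so a superlevel set
of the mass is itself a member of the chain. This makes the second composite contiguous to the
identity. -/
theorem mem_support_of_mem_support_subdivide_barycenter [K.IsInvariant G]
    (z : (orderComplex K.Face).Realization) (s : K.Face)
    (hs : s ∈ (subdivide K G ((barycenter K G).realize z)).weight.support) :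
    s ∈ z.weight.support := by
  rw [mem_support_subdivide] at hs
  obtain ⟨w, hw, hmin⟩ := s.1.exists_min_image ((barycenter K G).mass z) s.nonempty
  have hlt : ∀ u ∉ s.1, (barycenter K G).mass z u < (barycenter K G).mass z w := fun u hu =>
    ((barycenter K G).realize_lt_realize z).1 ((hs w hw).2 u hu)
  have hw' := Finsupp.mem_support_iff.2 (hs w hw).1.ne'
  rw [Carrier.support_realize] at hw'
  obtain ⟨c, hc, hwc⟩ := Finset.mem_biUnion.1 hw'
  have hface : z.weight.support.filter (fun t => w ∈ t.1) ∈ (orderComplex K.Face).faces :=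
    mem_faces_of_subset z.support_mem (Finset.filter_subset _ _)
      ⟨c, Finset.mem_filter.2 ⟨hc, hwc⟩⟩
  obtain ⟨t, ht, htmin⟩ := exists_isMin_of_isChain hface
  obtain ⟨ht, hwt⟩ := Finset.mem_filter.1 ht
  have key : ∀ t' ∈ z.weight.support, w ∈ t'.1 → t ≤ t' := fun t' h h' =>
    htmin t' (Finset.mem_filter.2 ⟨h, h'⟩)
  -- Here `w` has least mass in `s`, and `t` is the smallest chain member containing `w`. A vertex
  -- of `s` outside `t` would miss the weight of `t` and be lighter than `w`; a vertex of `t` lies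
  -- in every member containing `w`, so it is at least as heavy and belongs to `s`.
  have : s = t := by
    refine Subtype.ext (Finset.ext fun v => ⟨fun hv => ?_, fun hv => ?_⟩)
    · by_contra hvt
      refine absurd (hmin v hv) (not_le.2 ?_)
      refine Finset.sum_lt_sum (fun t' ht' => ?_) ⟨t, ht, ?_⟩
      · by_cases hv' : v ∈ t'.1
        · have hle : t ≤ t' := (z.support_mem.2.total ht ht').resolve_right
            fun h => hvt (h hv')
          rw [if_pos (show v ∈ (barycenter K G).toFun t' from hv'),
          if_pos (show w ∈ ((barycenter K G).toFun t') from hle hwt)]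
        · rw [if_neg (show v ∉ (barycenter K G).toFun t' from hv')]
          exact (barycenter K G).mass_term_nonneg z w t'
      · rw [if_neg (show v ∉ (barycenter K G).toFun t from hvt),
          if_pos (show w ∈ ((barycenter K G).toFun t) from hwt)]
        exact Realization.weight_pos ht
    · by_contra hvs
      refine absurd (hlt v hvs) (not_lt.2 (Finset.sum_le_sum fun t' ht' => ?_))
      by_cases hw' : w ∈ t'.1
      · rw [if_pos (show w ∈ (barycenter K G).toFun t' from hw'),
          if_pos (show v ∈ ((barycenter K G).toFun t') from key t' ht' hw' hv)]
      · rw [if_neg (show w ∉ (barycenter K G).toFun t' from hw')]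
        exact (barycenter K G).mass_term_nonneg z v t'
  rwa [this]

theorem subdivide_comp_barycenter [K.IsInvariant G] :
    ((subdivide K G).comp (barycenter K G).realize).Homotopic (GMap.id (orderComplex K.Face) G) :=
  GMap.Homotopic.of_contiguous fun z => ⟨_, z.support_mem,
    fun s hs => mem_support_of_mem_support_subdivide_barycenter z s hs, Finset.Subset.refl _⟩

/-! ### Maps of posets -/

section Poset

variable {P Q : Type*} [PartialOrder P] [PartialOrder Q] [MulAction G P] [MulAction G Q]

/-- The simplicial map of order complexes defined by an equivariant map that preserves
comparability. -/
def Carrier.ofComparable (φ : P → Q) (h : ∀ p q, p ≤ q → φ p ≤ φ q ∨ φ q ≤ φ p)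
    (hG : ∀ (g : G) p, φ (g • p) = g • φ p) : Carrier G (orderComplex P) (orderComplex Q) where
  toFun p := {φ p}
  biUnion_mem c hc := by
    rw [Finset.biUnion_singleton]
    refine ⟨hc.1.image φ, ?_⟩
    rintro _ hx _ hy -
    obtain ⟨p, hp, rfl⟩ := Finset.mem_image.1 (Finset.mem_coe.1 hx)
    obtain ⟨q, hq, rfl⟩ := Finset.mem_image.1 (Finset.mem_coe.1 hy)
    exact (hc.2.total hp hq).elim (h p q) fun h' => (h q p h').symm
  smul_mem g p q hq := by
    rw [Finset.mem_singleton] at hq ⊢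
    rw [hq, hG]

variable [CovariantClass G P HSMul.hSMul LE.le] [CovariantClass G Q HSMul.hSMul LE.le]

theorem support_realize_ofComparable (φ : P → Q) (h : ∀ p q, p ≤ q → φ p ≤ φ q ∨ φ q ≤ φ p)
    (hG : ∀ (g : G) p, φ (g • p) = g • φ p) (x : (orderComplex P).Realization) :
    ((Carrier.ofComparable φ h hG).realize x).weight.support = x.weight.support.image φ := by
  rw [Carrier.support_realize, ← Finset.biUnion_singleton]
  rfl

theorem mem_support_realize_ofComparable (φ : P → Q) (h : ∀ p q, p ≤ q → φ p ≤ φ q ∨ φ q ≤ φ p)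
    (hG : ∀ (g : G) p, φ (g • p) = g • φ p) {x : (orderComplex P).Realization} {q : Q} :
    q ∈ ((Carrier.ofComparable φ h hG).realize x).weight.support ↔
      ∃ p ∈ x.weight.support, φ p = q := by
  rw [support_realize_ofComparable, Finset.mem_image]

/-- The largest element of a finite chain. -/
def chainMax (c : (orderComplex P).Face) : P := (exists_isMax_of_isChain c.2).choose

theorem chainMax_mem (c : (orderComplex P).Face) : chainMax c ∈ c.1 :=
  (exists_isMax_of_isChain c.2).choose_spec.1

theorem le_chainMax {c : (orderComplex P).Face} {p : P} (hp : p ∈ c.1) : p ≤ chainMax c :=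
  (exists_isMax_of_isChain c.2).choose_spec.2 p hp

/-- The smallest element of a finite chain. -/
def chainMin (c : (orderComplex P).Face) : P := (exists_isMin_of_isChain c.2).choose

theorem chainMin_mem (c : (orderComplex P).Face) : chainMin c ∈ c.1 :=
  (exists_isMin_of_isChain c.2).choose_spec.1

theorem chainMin_le {c : (orderComplex P).Face} {p : P} (hp : p ∈ c.1) : chainMin c ≤ p :=
  (exists_isMin_of_isChain c.2).choose_spec.2 p hp

omit [MulAction G P] [CovariantClass G P HSMul.hSMul LE.le] in
theorem chainMax_mono {c d : (orderComplex P).Face} (h : c ≤ d) : chainMax c ≤ chainMax d :=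
  le_chainMax (h (chainMax_mem c))

omit [MulAction G P] [CovariantClass G P HSMul.hSMul LE.le] in
theorem chainMin_anti {c d : (orderComplex P).Face} (h : c ≤ d) : chainMin d ≤ chainMin c :=
  chainMin_le (h (chainMin_mem c))

theorem chainMax_smul (g : G) (c : (orderComplex P).Face) : chainMax (g • c) = g • chainMax c := by
  refine le_antisymm ?_ (le_chainMax (Face.smul_mem_smul_iff.2 (chainMax_mem c)))
  obtain ⟨p, hp, h⟩ := Face.mem_smul_iff.1 (chainMax_mem (g • c))
  rw [← h]
  exact smul_mono_right g (le_chainMax hp)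

theorem chainMin_smul (g : G) (c : (orderComplex P).Face) : chainMin (g • c) = g • chainMin c := by
  refine le_antisymm (chainMin_le (Face.smul_mem_smul_iff.2 (chainMin_mem c))) ?_
  obtain ⟨p, hp, h⟩ := Face.mem_smul_iff.1 (chainMin_mem (g • c))
  rw [← h]
  exact smul_mono_right g (chainMin_le hp)

variable (P G) in
/-- The simplicial map sending a chain to its largest element. -/
def maxCarrier : Carrier G (orderComplex (orderComplex P).Face) (orderComplex P) :=
  Carrier.ofComparable chainMax (fun _ _ h => Or.inl (chainMax_mono h)) chainMax_smul

variable (P G) in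
/-- The simplicial map sending a chain to its smallest element. -/
def minCarrier : Carrier G (orderComplex (orderComplex P).Face) (orderComplex P) :=
  Carrier.ofComparable chainMin (fun _ _ h => Or.inr (chainMin_anti h)) chainMin_smul

theorem mem_support_realize_maxCarrier {z : (orderComplex (orderComplex P).Face).Realization}
    {p : P} : p ∈ ((maxCarrier G P).realize z).weight.support ↔
      ∃ c ∈ z.weight.support, chainMax c = p :=
  mem_support_realize_ofComparable _ _ _

theorem mem_support_realize_minCarrier {z : (orderComplex (orderComplex P).Face).Realization}
    {p : P} : p ∈ ((minCarrier G P).realize z).weight.support ↔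
      ∃ c ∈ z.weight.support, chainMin c = p :=
  mem_support_realize_ofComparable _ _ _

/-- Subdividing a point produces chains inside its support, and choosing an element of each stays in
that support. -/
theorem ofComparable_comp_subdivide (φ : (orderComplex P).Face → P)
    (h : ∀ p q, p ≤ q → φ p ≤ φ q ∨ φ q ≤ φ p) (hG : ∀ (g : G) p, φ (g • p) = g • φ p)
    (hφ : ∀ c, φ c ∈ c.1) :
    ((Carrier.ofComparable φ h hG).realize.comp (subdivide (orderComplex P) G)).Homotopic
      (GMap.id (orderComplex P) G) := by
  refine GMap.Homotopic.of_contiguous fun x => ⟨_, x.support_mem, ?_, Finset.Subset.refl _⟩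
  change ((Carrier.ofComparable φ h hG).realize (subdivide (orderComplex P) G x)).weight.support ⊆ _
  rw [support_realize_ofComparable]
  exact Finset.image_subset_iff.2 fun c hc => subset_of_mem_support_subdivide hc (hφ c)

theorem maxCarrier_comp_subdivide :
    ((maxCarrier G P).realize.comp (subdivide (orderComplex P) G)).Homotopic
      (GMap.id (orderComplex P) G) :=
  ofComparable_comp_subdivide _ _ _ chainMax_mem

theorem minCarrier_comp_subdivide :
    ((minCarrier G P).realize.comp (subdivide (orderComplex P) G)).Homotopic
      (GMap.id (orderComplex P) G) :=
  ofComparable_comp_subdivide _ _ _ chainMin_mem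

/-- Comparable order-reversing maps are homotopic. -/
theorem homotopic_of_antitone_of_le {φ ψ : P → Q} (hφ : Antitone φ) (hψ : Antitone ψ)
    (hφG : ∀ (g : G) p, φ (g • p) = g • φ p) (hψG : ∀ (g : G) p, ψ (g • p) = g • ψ p)
    (hle : ∀ p, φ p ≤ ψ p) :
    (Carrier.ofComparable φ (fun _ _ h => Or.inr (hφ h)) hφG).realize.Homotopic
      (Carrier.ofComparable ψ (fun _ _ h => Or.inr (hψ h)) hψG).realize := by
  set f := (Carrier.ofComparable φ (fun _ _ h => Or.inr (hφ h)) hφG).realize with hf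
  set f' := (Carrier.ofComparable ψ (fun _ _ h => Or.inr (hψ h)) hψG).realize with hf'
  -- For p ≤ q the values φ p and ψ q need not be comparable, so the two maps need not be contiguous
  -- on the order complex itself. After one subdivision, maxima are used for φ and minima for ψ.
  have h1 : (f.comp (maxCarrier G P).realize).Homotopic (f'.comp (minCarrier G P).realize) := by
    refine GMap.Homotopic.of_contiguous fun z =>
      ⟨z.weight.support.image (φ ∘ chainMax) ∪ z.weight.support.image (ψ ∘ chainMin),
        ⟨(z.support_nonempty.image _).mono Finset.subset_union_left, ?_⟩, ?_, ?_⟩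
    · have hcross : ∀ c ∈ z.weight.support, ∀ d ∈ z.weight.support,
          φ (chainMax c) ≤ ψ (chainMin d) := by
        intro c hc d hd
        -- For nested chains, the minimum of either one is at most the maximum of the other.
        refine (hφ ?_).trans (hle _)
        obtain h | h := z.support_mem.2.total hc hd
        · exact chainMin_le (h (chainMax_mem c))
        · exact (chainMin_le (chainMax_mem d)).trans (chainMax_mono h)
      intro a ha b hb _
      simp only [Finset.coe_union, Finset.coe_image, Set.mem_union, Set.mem_image,
        Finset.mem_coe, Function.comp_apply] at ha hb
      obtain ⟨c, hc, rfl⟩ | ⟨c, hc, rfl⟩ := ha <;> obtain ⟨d, hd, rfl⟩ | ⟨d, hd, rfl⟩ := hb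
      · exact (z.support_mem.2.total hc hd).symm.imp (fun h => hφ (chainMax_mono h))
          fun h => hφ (chainMax_mono h)
      · exact Or.inl (hcross c hc d hd)
      · exact Or.inr (hcross d hd c hc)
      · exact (z.support_mem.2.total hc hd).imp (fun h => hψ (chainMin_anti h))
          fun h => hψ (chainMin_anti h)
    · change (f ((maxCarrier G P).realize z)).weight.support ⊆ _
      rw [hf, support_realize_ofComparable, maxCarrier, support_realize_ofComparable,
        Finset.image_image]
      exact Finset.subset_union_left
    · change (f' ((minCarrier G P).realize z)).weight.support ⊆ _
      rw [hf', support_realize_ofComparable, minCarrier, support_realize_ofComparable,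
        Finset.image_image]
      exact Finset.subset_union_right
  exact ((maxCarrier_comp_subdivide.comp_left f).symm.trans (h1.comp_right _)).trans
    (minCarrier_comp_subdivide.comp_left f')

end Poset

/-! ### Naturality of the subdivision -/

section Naturality

variable [K.IsInvariant G] [L.IsInvariant G] (r : Carrier G K L)

/-- The map of face posets induced by a carrier. -/
def Carrier.faceMap (s : K.Face) : L.Face := ⟨s.1.biUnion r.toFun, r.biUnion_mem s.1 s.2⟩

omit [K.IsInvariant G] [L.IsInvariant G] in
theorem Carrier.faceMap_mono : Monotone r.faceMap := fun _ _ h =>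
  Finset.biUnion_subset_biUnion_of_subset_left _ h

theorem Carrier.faceMap_smul (g : G) (s : K.Face) : r.faceMap (g • s) = g • r.faceMap s := by
  refine Subtype.ext (Finset.ext fun w => ?_)
  obtain ⟨w, rfl⟩ := MulAction.surjective g w
  rw [Face.smul_mem_smul_iff]
  simp only [faceMap, Finset.mem_biUnion, Face.mem_smul_iff]
  constructor
  · rintro ⟨_, ⟨v, hv, rfl⟩, hw⟩
    exact ⟨v, hv, (r.smul_mem_iff g v w).1 hw⟩
  · rintro ⟨v, hv, hw⟩
    exact ⟨_, ⟨v, hv, rfl⟩, r.smul_mem g v w hw⟩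

/-- The simplicial map of barycentric subdivisions induced by a carrier. -/
def Carrier.face : Carrier G (orderComplex K.Face) (orderComplex L.Face) :=
  Carrier.ofComparable r.faceMap (fun _ _ h => Or.inl (r.faceMap_mono h)) r.faceMap_smul

theorem Carrier.mem_support_realize_face {z : (orderComplex K.Face).Realization} {t : L.Face} :
    t ∈ (r.face.realize z).weight.support ↔ ∃ s ∈ z.weight.support, r.faceMap s = t :=
  mem_support_realize_ofComparable _ _ _

/-- Naturality is easy for `barycenter`, where both ways around the square have contiguous values.
It passes to `subdivide` because the two are homotopy inverse to each other. -/
theorem subdivide_comp_realize :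
    ((subdivide L G).comp r.realize).Homotopic (r.face.realize.comp (subdivide K G)) := by
  have h : ((barycenter L G).realize.comp r.face.realize).Homotopic
      (r.realize.comp (barycenter K G).realize) := by
    refine GMap.Homotopic.of_contiguous fun z => ⟨_, (r.realize _).support_mem, ?_,
      Finset.Subset.refl _⟩
    change ((barycenter L G).realize (r.face.realize z)).weight.support ⊆
      (r.realize ((barycenter K G).realize z)).weight.support
    rw [Carrier.support_realize (barycenter L G), Carrier.support_realize r,
      Carrier.support_realize (barycenter K G)]
    intro w hw
    obtain ⟨_, ht, hw⟩ := Finset.mem_biUnion.1 hw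
    obtain ⟨s, hs, rfl⟩ := r.mem_support_realize_face.1 ht
    obtain ⟨v, hv, hw⟩ := Finset.mem_biUnion.1 hw
    exact Finset.mem_biUnion.2 ⟨v, Finset.mem_biUnion.2 ⟨s, hs, hv⟩, hw⟩
  have h1 := (barycenter_comp_subdivide (K := K) (G := G)).comp_left
    ((subdivide L G).comp r.realize)
  have h2 := (h.comp_left (subdivide L G)).comp_right (subdivide K G)
  have h3 := (subdivide_comp_barycenter (K := L) (G := G)).comp_right
    (r.face.realize.comp (subdivide K G))
  exact h1.symm.trans (h2.symm.trans h3)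

end Naturality

end Subdivision

end PreAbstractSimplicialComplex
end

noncomputable section

/-! ### Submodules spanned by parts of a basis -/

section Bases

variable {R : Type*} [CommRing R] {M : Type*} [AddCommGroup M] [Module R M]

theorem exists_isBasisOf (N : Submodule R M) [Module.Free R N] : ∃ B : Set M, IsBasisOf R B N := by
  let b := Module.Free.chooseBasis R N
  refine ⟨Set.range (N.subtype ∘ b),
    (b.linearIndependent.map' N.subtype N.ker_subtype).linearIndepOn_id, ?_⟩
  rw [Set.range_comp, Submodule.span_image, b.span_eq, Submodule.map_top, Submodule.range_subtype]

theorem IsBasisOf.free {B : Set M} {N : Submodule R M} (h : IsBasisOf R B N) :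
    Module.Free R N := by
  obtain ⟨hB, rfl⟩ := h
  have h := Module.Free.of_basis (Module.Basis.span (v := ((↑) : B → M)) hB)
  rwa [Subtype.range_coe] at h

theorem IsBasisOf.union {B C : Set M} {N Q : Submodule R M} (hB : IsBasisOf R B N)
    (hC : IsBasisOf R C Q) (h : Disjoint N Q) : IsBasisOf R (B ∪ C) (N ⊔ Q) := by
  refine ⟨hB.1.id_union hC.1 ?_, ?_⟩
  · rwa [hB.2, hC.2]
  · rw [Submodule.span_union, hB.2, hC.2]

theorem IsBasisOf.biUnion {S : Set (Submodule R M)} (hS : sSupIndep S)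
    {B : Submodule R M → Set M} (hB : ∀ N ∈ S, IsBasisOf R (B N) N) :
    IsBasisOf R (⋃ N ∈ S, B N) (sSup S) := by
  rw [Set.biUnion_eq_iUnion]
  have hspan : ∀ N : S, Submodule.span R (B N) = N := fun N => (hB N N.2).2
  refine ⟨linearIndepOn_id_iUnion_finite (fun N => (hB N N.2).1) fun N t _ hN => ?_, ?_⟩
  · simp only [hspan]
    refine Disjoint.mono_right ?_ ((sSupIndep_iff S).1 hS N)
    refine biSup_mono fun N' hN' h => hN ?_
    rwa [h] at hN'
  · rw [Submodule.span_iUnion, sSup_eq_iSup']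
    exact iSup_congr hspan

variable {ι : Type*}

/-- The submodule `N` is spanned by a part of the basis `b`. -/
def IsCoordinate (b : Module.Basis ι R M) (N : Submodule R M) : Prop :=
  ∃ C : Set ι, N = Submodule.span R (b '' C)

namespace IsCoordinate

variable {b : Module.Basis ι R M} {N N' : Submodule R M}

theorem top : IsCoordinate b ⊤ := ⟨Set.univ, by rw [Set.image_univ, b.span_eq]⟩

/-- Membership in such a span is a condition on the support of the coordinate vector, so
intersections of spans become intersections of index sets. -/
theorem span_inf_span (C D : Set ι) :
    Submodule.span R (b '' C) ⊓ Submodule.span R (b '' D) = Submodule.span R (b '' (C ∩ D)) := by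
  ext m
  rw [Submodule.mem_inf]
  simp only [Module.Basis.mem_span_image, Set.subset_inter_iff]

theorem inf (hN : IsCoordinate b N) (hN' : IsCoordinate b N') : IsCoordinate b (N ⊓ N') := by
  obtain ⟨C, rfl⟩ := hN
  obtain ⟨D, rfl⟩ := hN'
  exact ⟨C ∩ D, span_inf_span C D⟩

theorem finset_inf {t : Finset (Submodule R M)} (h : ∀ N ∈ t, IsCoordinate b N) :
    IsCoordinate b (t.inf id) := by
  classical
  induction t using Finset.induction_on with
  | empty => exact top
  | insert N t _ ih =>
    rw [Finset.inf_insert]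
    exact (h N (Finset.mem_insert_self N t)).inf (ih fun N' h' => h N' (Finset.mem_insert_of_mem h'))

theorem sSup_mem {S : Set (Submodule R M)} (h : ∀ N ∈ S, IsCoordinate b N) :
    IsCoordinate b (sSup S) := by
  choose! C hC using h
  refine ⟨⋃ N ∈ S, C N, ?_⟩
  rw [Set.image_iUnion₂, Submodule.span_iUnion₂, sSup_eq_iSup]
  exact biSup_congr hC

theorem exists_isBasisOf (hN : IsCoordinate b N) : ∃ C ⊆ Set.range b, IsBasisOf R C N := by
  obtain ⟨C, rfl⟩ := hN
  exact ⟨b '' C, Set.image_subset_range b C,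
    b.linearIndependent.linearIndepOn_id.mono (Set.image_subset_range b C), rfl⟩

theorem free (hN : IsCoordinate b N) : Module.Free R N := by
  obtain ⟨C, -, hC⟩ := hN.exists_isBasisOf
  exact hC.free

theorem exists_isCompl (hN : IsCoordinate b N) : ∃ Q, IsCoordinate b Q ∧ IsCompl N Q := by
  obtain ⟨C, rfl⟩ := hN
  refine ⟨_, ⟨Cᶜ, rfl⟩, ?_, ?_⟩
  · rw [disjoint_iff, span_inf_span, Set.inter_compl_self, Set.image_empty, Submodule.span_empty]
  · rw [codisjoint_iff, ← Submodule.span_union, ← Set.image_union, Set.union_compl_self,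
      Set.image_univ, b.span_eq]

/-- Disjointness of coordinate submodules is distributive. -/
theorem disjoint_sSup {S : Set (Submodule R M)} (hN : IsCoordinate b N)
    (h : ∀ N ∈ S, IsCoordinate b N) (hd : ∀ N' ∈ S, Disjoint N N') :
    Disjoint N (sSup S) := by
  -- Basis vectors are non-zero only over a non-trivial ring.
  nontriviality R
  obtain ⟨D, rfl⟩ := hN
  choose! C hC using h
  have hS : sSup S = Submodule.span R (b '' ⋃ N ∈ S, C N) := by
    rw [Set.image_iUnion₂, Submodule.span_iUnion₂, sSup_eq_iSup]
    exact biSup_congr hC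
  rw [hS, disjoint_iff, span_inf_span]
  have : D ∩ ⋃ N ∈ S, C N = ∅ := by
    refine Set.eq_empty_of_forall_notMem fun i hi => ?_
    obtain ⟨N', hN', hi'⟩ := Set.mem_iUnion₂.1 hi.2
    refine b.ne_zero i (Submodule.disjoint_def.1 (hd N' hN') (b i)
      (Submodule.subset_span (Set.mem_image_of_mem b hi.1)) ?_)
    rw [hC N' hN']
    exact Submodule.subset_span (Set.mem_image_of_mem b hi')
  rw [this, Set.image_empty, Submodule.span_empty]

/-- Pairwise disjoint coordinate submodules form a partial decomposition. -/
theorem exists_isFreeDecomposition {S : Set (Submodule R M)} (hfin : S.Finite)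
    (h : ∀ N ∈ S, IsCoordinate b N) (hne : ∀ N ∈ S, N ≠ ⊥) (hd : S.PairwiseDisjoint id) :
    ∃ τ, IsFreeDecomposition R τ ∧ S ⊆ τ := by
  obtain ⟨Q, hQ, hSQ⟩ := (IsCoordinate.sSup_mem h).exists_isCompl
  have hcoord : ∀ N ∈ S ∪ {Q} \ {⊥}, IsCoordinate b N := by
    rintro N (hN | ⟨rfl, -⟩)
    exacts [h N hN, hQ]
  -- A coordinate complement completes the family; it is dropped if zero, since zero summands are
  -- not allowed.
  refine ⟨S ∪ {Q} \ {⊥}, ⟨hfin.union ((Set.finite_singleton Q).subset Set.sdiff_subset), ?_,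
    fun N hN => (hcoord N hN).free, fun N hN => ?_, ?_⟩, Set.subset_union_left⟩
  · rintro N (hN | ⟨-, hN⟩)
    exacts [hne N hN, hN]
  · refine (hcoord N hN).disjoint_sSup (S := (S ∪ {Q} \ {⊥}) \ {N})
      (fun N' hN' => hcoord N' hN'.1) ?_
    rintro N' ⟨hN', hNN'⟩
    obtain hN | ⟨rfl, -⟩ := hN
    · obtain hN' | ⟨rfl, -⟩ := hN'
      · exact hd hN hN' (Ne.symm hNN')
      · exact hSQ.disjoint.mono_left (le_sSup hN)
    · obtain hN' | ⟨rfl, -⟩ := hN'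
      · exact (hSQ.disjoint.mono_left (le_sSup hN')).symm
      · exact absurd rfl hNN'
  · rw [sSup_union, sSup_sdiff_singleton_bot, sSup_singleton, hSQ.sup_eq_top]

end IsCoordinate

theorem mem_commonBasisComplex_of_isCoordinate {σ : Finset (Submodule R M)}
    (hσ : σ.Nonempty) (b : Module.Basis ι R M)
    (h : ∀ N ∈ σ, N ≠ ⊥ ∧ N ≠ ⊤ ∧ IsCoordinate b N) : σ ∈ (commonBasisComplex R M).faces := by
  refine ⟨hσ, fun N hN => ?_, Set.range b, ⟨b.linearIndependent.linearIndepOn_id, b.span_eq⟩,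
    fun N hN => (h N hN).2.2.exists_isBasisOf⟩
  obtain ⟨h1, h2, h3⟩ := h N hN
  obtain ⟨Q, -, hQ⟩ := h3.exists_isCompl
  exact ⟨h1, h2, ⟨Q, hQ⟩, h3.free⟩

theorem exists_basis_of_mem_commonBasisComplex {σ : Finset (Submodule R M)}
    (hσ : σ ∈ (commonBasisComplex R M).faces) :
    ∃ (B : Set M) (b : Module.Basis B R M), ∀ N ∈ σ, IsCoordinate b N := by
  obtain ⟨-, -, B, ⟨hB, hspan⟩, h⟩ := hσ
  have hli : LinearIndependent R ((↑) : B → M) := hB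
  refine ⟨B, Module.Basis.mk hli (by rw [Subtype.range_coe, hspan]), fun N hN => ?_⟩
  obtain ⟨C, hCB, -, rfl⟩ := h N hN
  refine ⟨(↑) ⁻¹' C, ?_⟩
  rw [Module.Basis.coe_mk, Subtype.image_preimage_coe, Set.inter_eq_right.2 hCB]

end Bases

/-! ### Adapted bases for chains of partial decompositions -/

section Adapted

variable {R : Type u} [CommRing R] {M : Type u} [AddCommGroup M] [Module R M]

namespace PartialDecomposition

variable (σ : PartialDecomposition R M)

theorem finite_parts : σ.parts.Finite := by
  obtain ⟨τ, hτ, hσ⟩ := σ.exists_decomposition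
  exact hτ.finite.subset hσ

variable {σ} {N N' : Submodule R M}

theorem ne_bot (hN : N ∈ σ.parts) : N ≠ ⊥ := by
  obtain ⟨τ, hτ, hσ⟩ := σ.exists_decomposition
  exact hτ.ne_bot N (hσ hN)

theorem free (hN : N ∈ σ.parts) : Module.Free R N := by
  obtain ⟨τ, hτ, hσ⟩ := σ.exists_decomposition
  exact hτ.free N (hσ hN)

variable (σ) in
theorem sSupIndep_parts : sSupIndep σ.parts := by
  obtain ⟨τ, hτ, hσ⟩ := σ.exists_decomposition
  exact hτ.indep.mono hσ

theorem eq_or_disjoint (hN : N ∈ σ.parts) (hN' : N' ∈ σ.parts) : N = N' ∨ Disjoint N N' :=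
  or_iff_not_imp_left.2 fun h => σ.sSupIndep_parts.pairwiseDisjoint hN hN' h

/-- The remaining summands of a full decomposition span a complement. -/
theorem exists_isCompl_sSup {S : Set (Submodule R M)} (hS : S ⊆ σ.parts) :
    ∃ Q, IsCompl (sSup S) Q := by
  obtain ⟨τ, hτ, hσ⟩ := σ.exists_decomposition
  refine ⟨sSup (τ \ S), ?_, ?_⟩
  · have h := ((sSupIndep_iff τ).1 hτ.indep).disjoint_biSup_biSup
      (s := {N | N.1 ∈ S}) (t := {N | N.1 ∉ S}) (Set.disjoint_left.2 fun N h h' => h' h)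
    refine h.mono ?_ ?_
    · exact sSup_le fun N hN =>
        le_biSup (fun N : τ => N.1) (i := ⟨N, hσ (hS hN)⟩) (Set.mem_ofPred_eq ▸ hN)
    · exact sSup_le fun N hN =>
        le_biSup (fun N : τ => N.1) (i := ⟨N, hN.1⟩) (Set.mem_ofPred_eq ▸ hN.2)
  · rw [codisjoint_iff, ← sSup_union, Set.union_sdiff_cancel (hS.trans hσ), hτ.sSup_eq_top]

end PartialDecomposition

theorem finite_of_isCompl [Module.Finite R M] {N Q : Submodule R M} (h : IsCompl N Q) :
    Module.Finite R N :=
  Module.Finite.of_surjective (N.projectionOnto Q h) (Submodule.projectionOnto_surjective h)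

/-- This is where the hypothesis on `R` does its work: D ⊕ Q ≅ N with `D` and `N` free and finitely
generated, so `Q` is stably free. -/
theorem free_of_disjoint_of_sup_eq
    (hR : ∀ (P : Type u) [AddCommGroup P] [Module R P] [Module.Finite R P]
      [Module.IsStablyFree R P], Module.Free R P)
    {D Q N : Submodule R M} [Module.Free R D] [Module.Finite R D] [Module.Free R N]
    [Module.Finite R N] (hd : Disjoint D Q) (h : D ⊔ Q = N) : Module.Free R Q := by
  have hinj : Function.Injective (D.subtype.coprod Q.subtype) := by
    rw [← LinearMap.ker_eq_bot, LinearMap.ker_coprod_of_disjoint_range _ _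
      (by rwa [Submodule.range_subtype, Submodule.range_subtype]), Submodule.ker_subtype,
      Submodule.ker_subtype, Submodule.prod_bot]
  have hrange : LinearMap.range (D.subtype.coprod Q.subtype) = N := by
    rw [LinearMap.range_coprod, Submodule.range_subtype, Submodule.range_subtype, h]
  let e : (D × Q) ≃ₗ[R] N := (LinearEquiv.ofInjective _ hinj).trans (LinearEquiv.ofEq _ _ hrange)
  have : Module.Free R (D × Q) := Module.Free.of_equiv e.symm
  have : Module.Finite R (D × Q) := Module.Finite.equiv e.symm
  have : Module.Finite R Q :=
    Module.Finite.of_surjective (LinearMap.snd R D Q) LinearMap.snd_surjective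
  have : Module.IsStablyFree R Q := Module.IsStablyFree.of_free_prod' R Q D
  exact hR Q

/-- A chain of partial decompositions has a basis adapted to all summands. -/
theorem exists_adapted_basis [Module.Finite R M]
    (hR : ∀ (P : Type u) [AddCommGroup P] [Module R P] [Module.Finite R P]
      [Module.IsStablyFree R P], Module.Free R P)
    (c : Finset (PartialDecomposition R M)) (hc : IsChain (· ≤ ·) (c : Set (PartialDecomposition R M)))
    (N : Submodule R M) (hfree : Module.Free R N) (hfin : Module.Finite R N)
    (hN : ∀ σ ∈ c, ∀ N' ∈ σ.parts, N' ≤ N ∨ Disjoint N' N) :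
    ∃ B, IsBasisOf R B N ∧ ∀ σ ∈ c, ∀ N' ∈ σ.parts, N' ≤ N → ∃ C ⊆ B, IsBasisOf R C N' := by
  classical
  induction c using Finset.strongInduction generalizing N with
  | H c ih =>
    obtain rfl | hne := c.eq_empty_or_nonempty
    · obtain ⟨B, hB⟩ := exists_isBasisOf N
      exact ⟨B, hB, by simp⟩
    obtain ⟨σ, hσ, hmax⟩ := PreAbstractSimplicialComplex.exists_isMax_of_isChain ⟨hne, hc⟩
    let S : Set (Submodule R M) := {N' | N' ∈ σ.parts ∧ N' ≤ N}
    have hSσ : S ⊆ σ.parts := fun _ h => h.1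
    have hB : ∀ N' ∈ S, ∃ B, IsBasisOf R B N' ∧
        ∀ σ' ∈ c.erase σ, ∀ N'' ∈ σ'.parts, N'' ≤ N' → ∃ C ⊆ B, IsBasisOf R C N'' := by
      intro N' hN'
      refine ih _ (Finset.erase_ssubset hσ) (hc.mono (by simp)) N'
        (PartialDecomposition.free hN'.1) ?_ fun σ' hσ' N'' hN'' => ?_
      · obtain ⟨Q, hQ⟩ := σ.exists_isCompl_sSup (S := {N'}) (by simpa using hN'.1)
        rw [sSup_singleton] at hQ
        exact finite_of_isCompl hQ
      -- A finer summand lies in a single summand of the coarsest decomposition, which either is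
      -- `N'` or is disjoint from it.
      · obtain ⟨A, hA, hle⟩ := hmax σ' (Finset.mem_of_mem_erase hσ') N'' hN''
        obtain rfl | hd := PartialDecomposition.eq_or_disjoint hA hN'.1
        exacts [Or.inl hle, Or.inr (hd.mono_left hle)]
    choose! B hB hBc using hB
    have hD := IsBasisOf.biUnion (σ.sSupIndep_parts.mono hSσ) hB
    obtain ⟨D', hD'⟩ := σ.exists_isCompl_sSup hSσ
    have hDN : sSup S ≤ N := sSup_le fun _ h => h.2
    -- By the modular law, a complement of the sum in `M` cuts out a complement inside `N`. It is
    -- free, and any basis of it completes the adapted bases of the summands.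
    have hsup : sSup S ⊔ D' ⊓ N = N := by
      rw [← sup_inf_assoc_of_le _ hDN, hD'.sup_eq_top, top_inf_eq]
    have hdisj : Disjoint (sSup S) (D' ⊓ N) := hD'.disjoint.mono_right inf_le_left
    have := hD.free
    have := finite_of_isCompl hD'
    have := free_of_disjoint_of_sup_eq hR hdisj hsup
    obtain ⟨BQ, hBQ⟩ := exists_isBasisOf (D' ⊓ N)
    have hBN := hD.union hBQ hdisj
    rw [hsup] at hBN
    refine ⟨_, hBN, fun σ' hσ' N' hN' hle => ?_⟩
    obtain ⟨A, hA, hNA⟩ := hmax σ' hσ' N' hN'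
    have hAS : A ∈ S := by
      refine ⟨hA, (hN σ hσ A hA).resolve_right fun hd => ?_⟩
      exact PartialDecomposition.ne_bot hN' (disjoint_self.1 (hd.mono hNA hle))
    have hsub : B A ⊆ (⋃ N ∈ S, B N) ∪ BQ :=
      (Set.subset_biUnion_of_mem (u := B) hAS).trans Set.subset_union_left
    by_cases heq : σ' = σ
    · subst heq
      obtain rfl := σ'.eq_of_le hN' hA hNA
      exact ⟨B N', hsub, hB N' hAS⟩
    · obtain ⟨C, hC, hCN⟩ := hBc A hAS σ' (Finset.mem_erase.2 ⟨heq, hσ'⟩) N' hN' hNA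
      exact ⟨C, hC.trans hsub, hCN⟩

/-- Comparable summands are equal, so a summand equal to the whole module would be the only one. -/
theorem ProperPartialDecomposition.top_notMem_parts (σ : ProperPartialDecomposition R M) :
    ⊤ ∉ σ.1.parts := fun h => σ.2.2 (Set.eq_singleton_iff_unique_mem.2
  ⟨h, fun _ hN => σ.1.eq_of_le hN h le_top⟩)

theorem PartialDecomposition.smul_mem_parts_smul {G : Type*} [Group G] [DistribMulAction G M]
    [SMulCommClass G R M] {g : G} {σ : PartialDecomposition R M} {N : Submodule R M} :
    g • N ∈ (g • σ).parts ↔ N ∈ σ.parts :=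
  (MulAction.injective g).mem_set_image

open PreAbstractSimplicialComplex in
/-- A partial decomposition is carried to the simplex of its summands. -/
def partsCarrier (G : Type*) [Group G] [DistribMulAction G M] [SMulCommClass G R M]
    [Module.Free R M] [Module.Finite R M]
    (hR : ∀ (P : Type u) [AddCommGroup P] [Module R P] [Module.Finite R P]
      [Module.IsStablyFree R P], Module.Free R P) :
    Carrier G (orderComplex (ProperPartialDecomposition R M)) (commonBasisComplex R M) where
  toFun σ := σ.1.finite_parts.toFinset
  biUnion_mem c hc := by
    classical
    obtain ⟨B, hB, hBc⟩ := exists_adapted_basis hR (c.map (Function.Embedding.subtype _))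
      (by
        rw [Finset.coe_map]
        rintro _ ⟨σ, hσ, rfl⟩ _ ⟨σ', hσ', rfl⟩ -
        exact hc.2.total hσ hσ')
      ⊤ (Module.Free.of_equiv Submodule.topEquiv.symm)
      (Module.Finite.equiv Submodule.topEquiv.symm) (fun _ _ _ _ => Or.inl le_top)
    have hmem : ∀ N ∈ c.biUnion fun σ => σ.1.finite_parts.toFinset,
        ∃ σ ∈ c, N ∈ σ.1.parts := fun N hN => by simpa using hN
    refine ⟨?_, fun N hN => ?_, B, hB, fun N hN => ?_⟩
    · obtain ⟨σ, hσ⟩ := hc.1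
      obtain ⟨N, hN⟩ := Set.nonempty_iff_ne_empty.2 σ.2.1
      exact ⟨N, Finset.mem_biUnion.2 ⟨σ, hσ, by simpa using hN⟩⟩
    · obtain ⟨σ, -, hN⟩ := hmem N hN
      obtain ⟨Q, hQ⟩ := σ.1.exists_isCompl_sSup (S := {N}) (by simpa using hN)
      rw [sSup_singleton] at hQ
      exact ⟨PartialDecomposition.ne_bot hN, fun h => σ.top_notMem_parts (h ▸ hN), ⟨Q, hQ⟩,
        PartialDecomposition.free hN⟩
    · obtain ⟨σ, hσ, hN⟩ := hmem N hN
      exact hBc σ.1 (Finset.mem_map_of_mem _ hσ) N hN le_top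
  smul_mem g σ N hN := by
    rw [Set.Finite.mem_toFinset] at hN ⊢
    exact PartialDecomposition.smul_mem_parts_smul.2 hN

end Adapted

end

noncomputable section

/-! ### Minimal intersections -/

section Meets

open scoped Classical

variable {R : Type*} [CommRing R] {M : Type*} [AddCommGroup M] [Module R M]

/-- The proper non-zero intersections of members of `σ`. -/
def meets (σ : Finset (Submodule R M)) : Finset (Submodule R M) :=
  (σ.powerset.image fun t => t.inf id).filter fun A => A ≠ ⊥ ∧ A ≠ ⊤

theorem mem_meets {σ : Finset (Submodule R M)} {A : Submodule R M} :
    A ∈ meets σ ↔ (∃ t ⊆ σ, t.inf id = A) ∧ A ≠ ⊥ ∧ A ≠ ⊤ := by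
  simp [meets]

theorem meets_mono {σ σ' : Finset (Submodule R M)} (h : σ ⊆ σ') : meets σ ⊆ meets σ' := by
  intro A hA
  rw [mem_meets] at hA ⊢
  obtain ⟨⟨t, ht, hA⟩, hne⟩ := hA
  exact ⟨⟨t, ht.trans h, hA⟩, hne⟩

theorem inf_mem_meets {σ : Finset (Submodule R M)} {A A' : Submodule R M} (hA : A ∈ meets σ)
    (hA' : A' ∈ meets σ) (h : ¬ Disjoint A A') : A ⊓ A' ∈ meets σ := by
  rw [mem_meets] at hA hA' ⊢
  obtain ⟨⟨t, ht, rfl⟩, -, hA⟩ := hA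
  obtain ⟨⟨t', ht', rfl⟩, -⟩ := hA'
  exact ⟨⟨t ∪ t', Finset.union_subset ht ht', Finset.inf_union⟩, fun h' => h (disjoint_iff.2 h'),
    fun h' => hA (top_le_iff.1 (h' ▸ inf_le_left))⟩

/-- A minimal non-zero intersection is contained in or disjoint from any other intersection. -/
theorem Minimal.le_of_not_disjoint {σ : Finset (Submodule R M)} {A A' : Submodule R M}
    (hA : Minimal (· ∈ meets σ) A) (hA' : A' ∈ meets σ) (h : ¬ Disjoint A A') : A ≤ A' :=
  (hA.2 (inf_mem_meets hA.1 hA' h) inf_le_left).trans inf_le_right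

theorem subset_meets {σ : Finset (Submodule R M)} (hσ : σ ∈ (commonBasisComplex R M).faces) :
    σ ⊆ meets σ := fun N hN =>
  mem_meets.2 ⟨⟨{N}, Finset.singleton_subset_iff.2 hN, Finset.inf_singleton⟩,
    (hσ.2.1 N hN).1, (hσ.2.1 N hN).2.1⟩

theorem isCoordinate_of_mem_meets {ι : Type*} {b : Module.Basis ι R M}
    {σ : Finset (Submodule R M)} (h : ∀ N ∈ σ, IsCoordinate b N) :
    ∀ N ∈ meets σ, IsCoordinate b N := by
  intro N hN
  obtain ⟨⟨t, ht, rfl⟩, -⟩ := mem_meets.1 hN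
  exact IsCoordinate.finset_inf fun N hN => h N (ht hN)

/-- Intersections are spanned by parts of the same basis. This simplex supports the straight-line
homotopy on the common basis complex. -/
theorem meets_mem_commonBasisComplex {σ : Finset (Submodule R M)}
    (hσ : σ ∈ (commonBasisComplex R M).faces) : meets σ ∈ (commonBasisComplex R M).faces := by
  obtain ⟨B, b, hb⟩ := exists_basis_of_mem_commonBasisComplex hσ
  exact mem_commonBasisComplex_of_isCoordinate (hσ.1.mono (subset_meets hσ)) b fun N hN =>
    ⟨(mem_meets.1 hN).2.1, (mem_meets.1 hN).2.2, isCoordinate_of_mem_meets hb N hN⟩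

variable {G : Type*} [Group G] [DistribMulAction G M] [SMulCommClass G R M]

theorem smul_submodule_le_smul_iff {g : G} {N N' : Submodule R M} : g • N ≤ g • N' ↔ N ≤ N' := by
  rw [smul_eq_orderIso, smul_eq_orderIso, OrderIso.le_iff_le]

theorem smul_mem_meets {g : G} {σ : Finset (Submodule R M)} {A : Submodule R M}
    (hA : A ∈ meets σ) : g • A ∈ meets (σ.map (MulAction.toPerm g).toEmbedding) := by
  rw [mem_meets] at hA ⊢
  obtain ⟨⟨t, ht, rfl⟩, h1, h2⟩ := hA
  refine ⟨⟨t.map (MulAction.toPerm g).toEmbedding, Finset.map_subset_map.2 ht, ?_⟩,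
    smul_ne_bot g h1, smul_ne_top g h2⟩
  rw [Finset.inf_map, smul_eq_orderIso, map_finset_inf]
  rfl

open PreAbstractSimplicialComplex

theorem meets_face_mono {s t : (commonBasisComplex R M).Face} (h : s ≤ t) :
    meets s.1 ⊆ meets t.1 :=
  meets_mono h

theorem smul_mem_meets_smul_iff {g : G} {s : (commonBasisComplex R M).Face} {A : Submodule R M} :
    g • A ∈ meets (g • s).1 ↔ A ∈ meets s.1 := by
  refine ⟨fun h => ?_, smul_mem_meets⟩
  have h' : g⁻¹ • g • A ∈ meets (g⁻¹ • g • s).1 := smul_mem_meets h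
  rwa [inv_smul_smul, inv_smul_smul] at h'

theorem minimal_meets_smul_iff {g : G} {s : (commonBasisComplex R M).Face} {A : Submodule R M} :
    Minimal (· ∈ meets (g • s).1) (g • A) ↔ Minimal (· ∈ meets s.1) A := by
  refine and_congr smul_mem_meets_smul_iff ⟨fun h A' hA' hle => ?_, fun h A' hA' hle => ?_⟩
  · exact smul_submodule_le_smul_iff.1
      (h (smul_mem_meets_smul_iff.2 hA') (smul_submodule_le_smul_iff.2 hle))
  · obtain ⟨A', rfl⟩ := MulAction.surjective g A'
    exact smul_submodule_le_smul_iff.2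
      (h (smul_mem_meets_smul_iff.1 hA') (smul_submodule_le_smul_iff.1 hle))

theorem exists_le_minimal_meets {s : Finset (Submodule R M)} {A : Submodule R M}
    (hA : A ∈ meets s) : ∃ A' ≤ A, Minimal (· ∈ meets s) A' :=
  (meets s).exists_le_minimal hA

/-! ### The decomposition attached to a chain of simplices -/

/-- The minimal intersections for the largest simplex of a chain that are contained in minimal
intersections for all other simplices. -/
def chainParts (C : (orderComplex (commonBasisComplex R M).Face).Face) : Set (Submodule R M) :=
  {A | Minimal (· ∈ meets (chainMax C).1) A ∧
    ∀ s ∈ C.1, ∃ A', Minimal (· ∈ meets s.1) A' ∧ A ≤ A'}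

/-- Descend while climbing the chain: at each larger simplex, the intersection found so far is still
an intersection and can be shrunk to a minimal one. The extra bound `m` starts the induction, where
any vertex of `m` will do. -/
theorem exists_mem_meets_of_isChain (C : Finset (commonBasisComplex R M).Face)
    (hC : IsChain (· ≤ ·) (C : Set (commonBasisComplex R M).Face))
    (m : (commonBasisComplex R M).Face) (hm : ∀ s ∈ C, s ≤ m) :
    ∃ A ∈ meets m.1, ∀ s ∈ C, ∃ A', Minimal (· ∈ meets s.1) A' ∧ A ≤ A' := by
  induction C using Finset.strongInduction generalizing m with
  | H C ih =>
    obtain rfl | hne := C.eq_empty_or_nonempty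
    · obtain ⟨N, hN⟩ := m.nonempty
      exact ⟨N, subset_meets m.2 hN, by simp⟩
    obtain ⟨t, ht, hmax⟩ := exists_isMax_of_isChain ⟨hne, hC⟩
    obtain ⟨A₀, hA₀, h₀⟩ := ih (C.erase t) (Finset.erase_ssubset ht)
      (hC.mono (by simp)) t fun s hs => hmax s (Finset.mem_of_mem_erase hs)
    obtain ⟨A, hle, hA⟩ := exists_le_minimal_meets hA₀
    refine ⟨A, meets_face_mono (hm t ht) hA.1, fun s hs => ?_⟩
    by_cases hst : s = t
    · exact ⟨A, hst ▸ hA, le_rfl⟩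
    · obtain ⟨A', hA', h'⟩ := h₀ s (Finset.mem_erase.2 ⟨hst, hs⟩)
      exact ⟨A', hA', hle.trans h'⟩

theorem chainParts_nonempty (C : (orderComplex (commonBasisComplex R M).Face).Face) :
    (chainParts C).Nonempty := by
  obtain ⟨A₀, hA₀, h₀⟩ := exists_mem_meets_of_isChain C.1 C.2.2 (chainMax C)
    fun _ hs => le_chainMax hs
  obtain ⟨A, hle, hA⟩ := exists_le_minimal_meets hA₀
  refine ⟨A, hA, fun s hs => ?_⟩
  obtain ⟨A', hA', h'⟩ := h₀ s hs
  exact ⟨A', hA', hle.trans h'⟩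

theorem chainParts_subset_meets (C : (orderComplex (commonBasisComplex R M).Face).Face) :
    chainParts C ⊆ meets (chainMax C).1 := fun _ hA => hA.1.1

/-- The proper partial decomposition attached to a chain of simplices of the common basis
complex. -/
def chainDecomposition (C : (orderComplex (commonBasisComplex R M).Face).Face) :
    ProperPartialDecomposition R M :=
  ⟨{ parts := chainParts C
     exists_decomposition := by
      obtain ⟨B, b, hb⟩ := exists_basis_of_mem_commonBasisComplex (chainMax C).2
      refine IsCoordinate.exists_isFreeDecomposition (b := b)
        ((Finset.finite_toSet _).subset (chainParts_subset_meets C))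
        (fun N hN => isCoordinate_of_mem_meets hb N (chainParts_subset_meets C hN))
        (fun N hN => (mem_meets.1 (chainParts_subset_meets C hN)).2.1)
        fun A hA A' hA' hne => ?_
      by_contra h
      exact hne (le_antisymm (hA.1.le_of_not_disjoint hA'.1.1 h)
        (hA'.1.le_of_not_disjoint hA.1.1 fun h' => h h'.symm)) },
    (chainParts_nonempty C).ne_empty, fun h => by
      have htop : ⊤ ∈ chainParts C := by
        rw [show chainParts C = {⊤} from h]
        exact Set.mem_singleton ⊤
      exact (mem_meets.1 (chainParts_subset_meets C htop)).2.2 rfl⟩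

theorem mem_chainDecomposition {C : (orderComplex (commonBasisComplex R M).Face).Face}
    {A : Submodule R M} : A ∈ (chainDecomposition C).1.parts ↔
      Minimal (· ∈ meets (chainMax C).1) A ∧
        ∀ s ∈ C.1, ∃ A', Minimal (· ∈ meets s.1) A' ∧ A ≤ A' := Iff.rfl

/-- The maximum of the smaller chain belongs to the larger chain, so a summand `A` for the larger
chain lies in a minimal intersection `A'` for that maximum. For each member of the smaller chain,
`A'` meets the minimal intersection above `A` at least in `A` ≠ 0, so minimality puts `A'` inside
it. -/
theorem chainDecomposition_anti : Antitone (chainDecomposition (R := R) (M := M)) := by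
  intro C C' h A hA
  have hCC' : C.1 ⊆ C'.1 := h
  rw [mem_chainDecomposition] at hA
  obtain ⟨A', hA', hle⟩ := hA.2 (chainMax C) (hCC' (chainMax_mem C))
  refine ⟨A', mem_chainDecomposition.2 ⟨hA', fun s hs => ?_⟩, hle⟩
  obtain ⟨A'', hA'', hle'⟩ := hA.2 s (hCC' hs)
  refine ⟨A'', hA'', hA'.le_of_not_disjoint (meets_face_mono (le_chainMax hs) hA''.1) fun hd => ?_⟩
  exact (mem_meets.1 hA.1.1).2.1 (disjoint_self.1 (hd.mono hle hle'))

theorem chainDecomposition_smul (g : G) (C : (orderComplex (commonBasisComplex R M).Face).Face) :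
    chainDecomposition (g • C) = g • chainDecomposition C := by
  refine Subtype.ext (PartialDecomposition.ext (Set.ext fun A => ?_))
  obtain ⟨A, rfl⟩ := MulAction.surjective g A
  have h : g • A ∈ (g • chainDecomposition C).1.parts ↔ A ∈ (chainDecomposition C).1.parts :=
    (MulAction.injective g).mem_set_image
  rw [h, mem_chainDecomposition, mem_chainDecomposition, chainMax_smul, minimal_meets_smul_iff]
  refine and_congr Iff.rfl ⟨fun h s hs => ?_, fun h s hs => ?_⟩
  · obtain ⟨A', hA', hle⟩ := h (g • s) (Face.smul_mem_smul_iff.2 hs)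
    obtain ⟨A', rfl⟩ := MulAction.surjective g A'
    exact ⟨A', minimal_meets_smul_iff.1 hA', smul_submodule_le_smul_iff.1 hle⟩
  · obtain ⟨s, hs', rfl⟩ := Face.mem_smul_iff.1 hs
    obtain ⟨A', hA', hle⟩ := h s hs'
    exact ⟨g • A', minimal_meets_smul_iff.2 hA', smul_submodule_le_smul_iff.2 hle⟩

variable (R M G) in
/-- The simplicial map defined by `chainDecomposition`. -/
def decompositionCarrier :
    Carrier G (orderComplex (orderComplex (commonBasisComplex R M).Face).Face)
      (orderComplex (ProperPartialDecomposition R M)) :=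
  Carrier.ofComparable chainDecomposition (fun _ _ h => Or.inr (chainDecomposition_anti h))
    chainDecomposition_smul

theorem mem_support_realize_decompositionCarrier
    {z : (orderComplex (orderComplex (commonBasisComplex R M).Face).Face).Realization}
    {σ : ProperPartialDecomposition R M} :
    σ ∈ ((decompositionCarrier R M G).realize z).weight.support ↔
      ∃ C ∈ z.weight.support, chainDecomposition C = σ :=
  mem_support_realize_ofComparable _ _ _

end Meets

/-! ### The homotopy equivalence -/

section Main

open PreAbstractSimplicialComplex

variable {R : Type u} [CommRing R] {M : Type u} [AddCommGroup M] [Module R M]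
  [Module.Free R M] [Module.Finite R M]
  {G : Type*} [Group G] [DistribMulAction G M] [SMulCommClass G R M]
  (hR : ∀ (P : Type u) [AddCommGroup P] [Module R P] [Module.Finite R P]
    [Module.IsStablyFree R P], Module.Free R P)

theorem mem_faceMap_partsCarrier {c : (orderComplex (ProperPartialDecomposition R M)).Face}
    {N : Submodule R M} :
    N ∈ ((partsCarrier G hR).faceMap c).1 ↔ ∃ σ ∈ c.1, N ∈ σ.1.parts := by
  simp [Carrier.faceMap, partsCarrier]

theorem mem_faceMap_face_partsCarrier
    {C : (orderComplex (orderComplex (ProperPartialDecomposition R M)).Face).Face}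
    {s : (commonBasisComplex R M).Face} :
    s ∈ ((partsCarrier G hR).face.faceMap C).1 ↔ ∃ c ∈ C.1, (partsCarrier G hR).faceMap c = s := by
  simp [Carrier.faceMap, Carrier.face, Carrier.ofComparable, eq_comm]

/-- The summands of the smallest decomposition of a chain are minimal intersections of the summands
of all decompositions in the chain. -/
theorem minimal_meets_of_mem_chainMin {c : (orderComplex (ProperPartialDecomposition R M)).Face}
    {N : Submodule R M} (hN : N ∈ (chainMin c).1.parts) :
    Minimal (· ∈ meets ((partsCarrier G hR).faceMap c).1) N := by
  refine ⟨subset_meets ((partsCarrier G hR).faceMap c).2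
    ((mem_faceMap_partsCarrier hR).2 ⟨_, chainMin_mem c, hN⟩), fun A hA hle => ?_⟩
  obtain ⟨⟨t, ht, rfl⟩, hne, -⟩ := mem_meets.1 hA
  refine Finset.le_inf fun N' hN' => ?_
  obtain ⟨σ, hσ, hN'σ⟩ := (mem_faceMap_partsCarrier hR).1 (ht hN')
  obtain ⟨N'', hN'', hle'⟩ := chainMin_le hσ N hN
  -- The summand of `σ` containing `N` either is `N'` or is disjoint from `N'`; in the latter case
  -- the intersection, which lies in both, would be zero.
  obtain rfl | hd := PartialDecomposition.eq_or_disjoint hN'' hN'σ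
  · exact hle'
  · exact absurd (disjoint_self.1 (hd.mono (hle.trans hle') (Finset.inf_le hN'))) hne

/-- The larger a chain is, the finer its minimum. Summands of the minimum of the largest chain are
therefore contained in summands of the other minima, and all of these are minimal intersections by
`minimal_meets_of_mem_chainMin`. -/
theorem chainMin_chainMax_le
    (C : (orderComplex (orderComplex (ProperPartialDecomposition R M)).Face).Face) :
    chainMin (chainMax C) ≤ chainDecomposition ((partsCarrier G hR).face.faceMap C) := by
  have hmax : chainMax ((partsCarrier G hR).face.faceMap C) =
      (partsCarrier G hR).faceMap (chainMax C) := by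
    refine le_antisymm ?_
      (le_chainMax ((mem_faceMap_face_partsCarrier hR).2 ⟨_, chainMax_mem C, rfl⟩))
    obtain ⟨c, hc, h⟩ := (mem_faceMap_face_partsCarrier hR).1
      (chainMax_mem ((partsCarrier G hR).face.faceMap C))
    rw [← h]
    exact (partsCarrier G hR).faceMap_mono (le_chainMax hc)
  intro N hN
  refine ⟨N, mem_chainDecomposition.2 ⟨?_, fun s hs => ?_⟩, le_rfl⟩
  · rw [hmax]
    exact minimal_meets_of_mem_chainMin hR hN
  · obtain ⟨c, hc, rfl⟩ := (mem_faceMap_face_partsCarrier hR).1 hs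
    obtain ⟨N', hN', hle⟩ := chainMin_anti (le_chainMax hc) N hN
    exact ⟨N', minimal_meets_of_mem_chainMin hR hN', hle⟩

variable (R M G) in
/-- The comparison map from the common basis complex to the partial decompositions. -/
def toDecompositions : GMap G (commonBasisComplex R M)
    (orderComplex (ProperPartialDecomposition R M)) :=
  (decompositionCarrier R M G).realize.comp
    ((subdivide (orderComplex (commonBasisComplex R M).Face) G).comp
      (subdivide (commonBasisComplex R M) G))

omit [Module.Free R M] [Module.Finite R M] in
-- Neither subdivision leaves the support of `x`, and enlarging a simplex only adds intersections.
theorem mem_meets_of_mem_support_toDecompositions {x : (commonBasisComplex R M).Realization}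
    {σ : ProperPartialDecomposition R M} (hσ : σ ∈ (toDecompositions R M G x).weight.support)
    {N : Submodule R M} (hN : N ∈ σ.1.parts) : N ∈ meets x.weight.support := by
  obtain ⟨C, hC, rfl⟩ := mem_support_realize_decompositionCarrier.1 hσ
  have hC' : C.1 ⊆ (subdivide (commonBasisComplex R M) G x).weight.support :=
    subset_of_mem_support_subdivide hC
  have hsub : (chainMax C).1 ⊆ x.weight.support :=
    subset_of_mem_support_subdivide (Finset.mem_of_subset hC' (chainMax_mem C))
  exact Finset.mem_of_subset (meets_mono hsub) (mem_chainDecomposition.1 hN).1.1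

theorem partsCarrier_comp_toDecompositions :
    ((partsCarrier G hR).realize.comp (toDecompositions R M G)).Homotopic
      (GMap.id (commonBasisComplex R M) G) := by
  refine GMap.Homotopic.of_contiguous fun x =>
    ⟨meets x.weight.support, meets_mem_commonBasisComplex x.support_mem, fun N hN => ?_,
      subset_meets x.support_mem⟩
  change N ∈ ((partsCarrier G hR).realize (toDecompositions R M G x)).weight.support at hN
  rw [Carrier.support_realize] at hN
  obtain ⟨σ, hσ, hN⟩ := Finset.mem_biUnion.1 hN
  exact mem_meets_of_mem_support_toDecompositions hσ ((Set.Finite.mem_toFinset _).1 hN)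

theorem toDecompositions_comp_partsCarrier :
    ((toDecompositions R M G).comp (partsCarrier G hR).realize).Homotopic
      (GMap.id (orderComplex (ProperPartialDecomposition R M)) G) := by
  let r := partsCarrier (M := M) G hR
  let D := (decompositionCarrier R M G).realize
  let S₁ := subdivide (orderComplex (ProperPartialDecomposition R M)) G
  let S₂ := subdivide (orderComplex (orderComplex (ProperPartialDecomposition R M)).Face) G
  -- Naturality, used twice, moves both subdivisions to the side of the partial decompositions.
  have h1 : ((toDecompositions R M G).comp r.realize).Homotopic
      ((D.comp r.face.face.realize).comp (S₂.comp S₁)) :=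
    ((subdivide_comp_realize r).comp_left (D.comp (subdivide _ G))).trans
      (((subdivide_comp_realize r.face).comp_left D).comp_right S₁)
  have hanti : Antitone fun C => chainDecomposition (r.face.faceMap C) :=
    fun _ _ h => chainDecomposition_anti (r.face.faceMap_mono h)
  have hmin : Antitone fun C : (orderComplex (orderComplex
      (ProperPartialDecomposition R M)).Face).Face => chainMin (chainMax C) :=
    fun _ _ h => chainMin_anti (chainMax_mono h)
  have hantiG : ∀ (g : G) C, chainDecomposition (r.face.faceMap (g • C)) =
      g • chainDecomposition (r.face.faceMap C) := fun g C => by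
    rw [r.face.faceMap_smul, chainDecomposition_smul]
  have hminG : ∀ (g : G) (C : (orderComplex (orderComplex
      (ProperPartialDecomposition R M)).Face).Face),
      chainMin (chainMax (g • C)) = g • chainMin (chainMax C) := fun g C => by
    rw [chainMax_smul, chainMin_smul]
  let A := (Carrier.ofComparable _ (fun _ _ h => Or.inr (hanti h)) hantiG).realize
  let B := (Carrier.ofComparable _ (fun _ _ h => Or.inr (hmin h)) hminG).realize
  have h2 : (D.comp r.face.face.realize).Homotopic A := by
    refine GMap.Homotopic.of_contiguous fun x => ⟨_, (A x).support_mem, fun σ hσ => ?_,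
      Finset.Subset.refl _⟩
    change σ ∈ (D (r.face.face.realize x)).weight.support at hσ
    obtain ⟨E, hE, rfl⟩ := mem_support_realize_decompositionCarrier.1 hσ
    obtain ⟨C, hC, rfl⟩ := r.face.mem_support_realize_face.1 hE
    exact (mem_support_realize_ofComparable _ _ _).2 ⟨C, hC, rfl⟩
  have h3 : B.Homotopic A := homotopic_of_antitone_of_le hmin hanti hminG hantiG
    (chainMin_chainMax_le (G := G) hR)
  have h4 : B.Homotopic ((minCarrier G (ProperPartialDecomposition R M)).realize.comp
      (maxCarrier G (orderComplex (ProperPartialDecomposition R M)).Face).realize) := by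
    refine GMap.Homotopic.of_contiguous fun x => ⟨_, (B x).support_mem, Finset.Subset.refl _,
      fun σ hσ => ?_⟩
    change σ ∈ ((minCarrier G _).realize ((maxCarrier G _).realize x)).weight.support at hσ
    obtain ⟨E, hE, rfl⟩ := mem_support_realize_minCarrier.1 hσ
    obtain ⟨C, hC, rfl⟩ := mem_support_realize_maxCarrier.1 hE
    exact (mem_support_realize_ofComparable _ _ _).2 ⟨C, hC, rfl⟩
  have h5 := (h2.trans (h3.symm.trans h4)).comp_right (S₂.comp S₁)
  -- The maximum undoes the second subdivision, and the minimum then undoes the first.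
  have h6 := ((maxCarrier_comp_subdivide (G := G)
    (P := (orderComplex (ProperPartialDecomposition R M)).Face)).comp_left
      (minCarrier G (ProperPartialDecomposition R M)).realize).comp_right S₁
  exact h1.trans (h5.trans (h6.trans minCarrier_comp_subdivide))

include hR in
theorem equivariantlyHomotopyEquivalent_commonBasisComplex :
    EquivariantlyHomotopyEquivalent G (commonBasisComplex R M).Realization
      (orderComplex (ProperPartialDecomposition R M)).Realization :=
  ⟨(toDecompositions R M G).toContinuousMap, (partsCarrier G hR).realize.toContinuousMap,
    (toDecompositions R M G).equivariant, (partsCarrier G hR).realize.equivariant,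
    partsCarrier_comp_toDecompositions hR, toDecompositions_comp_partsCarrier hR⟩

end Main

end

/-- If every (finitely generated) stably free module over the commutative ring `R` is free, then
the common basis complex of `R^n` and the poset of proper non-empty partial direct sum
decompositions of `R^n` are `GL_n(R)`-homotopy equivalent. -/
theorem corollary1p1 {R : Type u} [CommRing R]
    (hR : ∀ (P : Type u) [AddCommGroup P] [Module R P] [Module.Finite R P]
      [Module.IsStablyFree R P], Module.Free R P)
    (n : ℕ) :
    EquivariantlyHomotopyEquivalent (GL (Fin n) R)
      (commonBasisComplex R (Fin n → R)).Realization
      (orderComplex (ProperPartialDecomposition R (Fin n → R))).Realization :=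
  equivariantlyHomotopyEquivalent_commonBasisComplex hR
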